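/- Let $\mathscr C$ be a Grothendieck category with a family $\{G_i\}_{i\in\Lambda}$ of finitely generated projective generators, and let $(T,\theta,\zeta)$ be a monad on $\mathscr C$ such that $T$ is exact and preserves colimits. Let $n\ge 0$, and let $\Delta=\{\Delta_k:T\to T\}_{k=0}^n$ be a higher derivation of order $n$ on $T$: the $\Delta_k$ are natural transformations with $\Delta_0=1_T$ and $\Delta_k\circ\theta=\theta\circ\sum_{i+j=k}\Delta_i*\Delta_j$ for $0\le k\le n$. A higher $\Delta$-derivation of order $n$ on a $T$-module $(N,f_N)$ is a family $\{D_k:N\to N\}_{k=0}^n$ of morphisms of $\mathscr C$ with $D_0=1_N$ and $D_k\circ f_N=f_N\circ\sum_{i+j=k}TD_i\circ(\Delta_j)_N$ for $0\le k\le n$. Let $EM_T$ be the Eilenberg–Moore category of $T$-modules and $\tau=(\mathscr T,\mathscr F)$ a hereditary torsion theory on $EM_T$. For a $T$-module $N$ let $N_\tau$ be its torsion submodule, and let $\mathscr L_{TG_i}$ be the set of submodules $I\subseteq TG_i$ with $TG_i/I\in\mathscr T$. Assume that $\tau$ is higher differential of order $n$: for every $T$-module $N$ and every higher $\Delta$-derivation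 $\{D_k\}$ of order $n$ on $N$, $D_k(N_\tau)\subseteq N_\tau$ for $0\le k\le n$. The module of quotients $Q_\tau(N)\in EM_T$ is determined by $EM_T(TG_i,Q_\tau(N))=\varinjlim_{I\in\mathscr L_{TG_i}}EM_T(I,N/N_\tau)$, naturally in $TG_i$, and $\Phi_N:N\to Q_\tau(N)$ is the morphism that sends $g:TG_i\to N$ to the class of $TG_i\xrightarrow{g}N\to N/N_\tau$. A morphism $E:Q_\tau(N)\to Q_\tau(N)$ of $\mathscr C$ acts on $EM_T(TG_i,Q_\tau(N))\cong\mathscr C(G_i,Q_\tau(N))$ by composition. Let $(M,f_M)$ be a $T$-module in $\mathscr F$ and $D=\{D_k\}_{k=0}^n$ a higher $\Delta$-derivation of order $n$ on $M$. For $I\in\mathscr L_{TG_i}$ and a morphism $f:I\to M$ in $EM_T$, a solution of the recursion started at $f$ consists of $K\in\mathscr L_{TG_i}$ with $K\subseteq I$ and morphisms $h_0,\dots,h_n:K\to M$ in $EM_T$ with $h_0=f|_K$, such that there is $K'\in\mathscr L_{TG_i}$ with $K'\subseteq K$, $(\Delta_j)_{G_i}(K')\subseteq K$ for $0\le j\le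 n$, and $$h_k=D_k\circ f-f\circ(\Delta_k)_{G_i}-\sum_{t+j=k,\ t,j>0}h_t\circ(\Delta_j)_{G_i}\quad\text{on }K'\qquad(1\le k\le n).$$ Then: (1) For all $i\in\Lambda$, $I\in\mathscr L_{TG_i}$ and $f:I\to M$ in $EM_T$, the recursion started at $f$ has a solution. (2) There is exactly one family $\widetilde D=\{\widetilde D_k:Q_\tau(M)\to Q_\tau(M)\}_{k=0}^n$ of morphisms of $\mathscr C$ such that for all $i$, $I$ and $f$ as in (1), every solution $(K,(h_k)_k)$ of the recursion started at $f$ and every $0\le k\le n$, $\widetilde D_k$ sends the class of $f$ in $EM_T(TG_i,Q_\tau(M))$ to the class of $h_k$. (3) $\widetilde D$ is a higher $\Delta$-derivation of order $n$ on $Q_\tau(M)$; in particular $\widetilde D_0=1_{Q_\tau(M)}$. (4) $\widetilde D_k\circ\Phi_M=\Phi_M\circ D_k$ for $0\le k\le n$. -/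

import Mathlib

open CategoryTheory CategoryTheory.Limits

universe v u w

namespace HigherDer

noncomputable section

section EilenbergMoore

variable {C : Type u} [Category.{v} C] [Abelian C]

/-- A left exact monad on an abelian category is additive. -/
instance monadAdditive (T : Monad C) [PreservesFiniteLimits T.toFunctor] :
    (T : C ⥤ C).Additive :=
  Functor.additive_of_preserves_binary_products T.toFunctor

variable (T : Monad C) [PreservesFiniteLimits T.toFunctor] [PreservesFiniteColimits T.toFunctor]

instance algebraHasFiniteLimits : HasFiniteLimits T.Algebra :=
  ⟨fun _ _ _ => hasLimitsOfShape_of_hasLimitsOfShape_createsLimitsOfShape T.forget⟩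

instance algebraHasFiniteColimits : HasFiniteColimits T.Algebra :=
  ⟨fun _ _ _ => hasColimitsOfShape_of_hasColimitsOfShape_createsColimitsOfShape T.forget⟩

instance forgetPreservesFiniteColimits : PreservesFiniteColimits T.forget :=
  ⟨fun _ _ _ => inferInstance⟩

/-- The Eilenberg-Moore category of an exact monad on an abelian category is abelian. -/
instance algebraAbelian : Abelian T.Algebra :=
  have : ∀ {X Y : T.Algebra} (f : X ⟶ Y), IsIso (Abelian.coimageImageComparison f) := by
    intro X Y f
    have : IsIso (T.forget.map (Abelian.coimageImageComparison f)) := by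
      rw [Arrow.isIso_iff_isIso_of_isIso
        (Abelian.PreservesCoimageImageComparison.iso T.forget f).hom]
      infer_instance
    exact isIso_of_reflects_iso _ T.forget
  Abelian.ofCoimageImageComparisonIsIso

/-- The Eilenberg-Moore category of an exact, colimit preserving monad on a Grothendieck category
is a Grothendieck category. -/
instance algebraGrothendieck [IsGrothendieckAbelian.{v} C] [PreservesColimits T.toFunctor] :
    IsGrothendieckAbelian.{v} T.Algebra := by
  have : HasColimits T.Algebra :=
    hasColimits_of_hasColimits_createsColimits T.forget
  refine { ab5OfSize := ⟨fun J _ _ => ?_⟩, hasSeparator := ⟨?_⟩ }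
  · exact HasExactColimitsOfShape.domain_of_functor J T.forget
  · obtain ⟨G, hG⟩ := HasSeparator.hasSeparator (C := C)
    refine ⟨T.free.obj G, ?_⟩
    rw [isSeparator_def]
    intro X Y f g h
    refine T.forget.map_injective ((isSeparator_def G).1 hG _ _ fun k => ?_)
    have := h ((T.adj.homEquiv G X).symm k)
    have h2 := congrArg (T.adj.homEquiv G Y) this
    simpa [Adjunction.homEquiv_naturality_right] using h2

end EilenbergMoore

section TorsionTheories

/-- A hereditary torsion theory: a pair `(torsion, torsionFree)` of full subcategories with no
nonzero morphism from a torsion to a torsion-free object, such that every object is an extension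
of a torsion-free object by a torsion object, and torsion objects are closed under subobjects. -/
structure HereditaryTorsionTheory (𝒟 : Type u) [Category.{v} 𝒟] [Abelian 𝒟] where
  torsion : ObjectProperty 𝒟
  torsionFree : ObjectProperty 𝒟
  hom_eq_zero : ∀ {X Y : 𝒟}, torsion X → torsionFree Y → ∀ f : X ⟶ Y, f = 0
  exists_shortExact : ∀ M : 𝒟, ∃ (M' M'' : 𝒟) (i : M' ⟶ M) (p : M ⟶ M'') (w : i ≫ p = 0),
    torsion M' ∧ torsionFree M'' ∧ (ShortComplex.mk i p w).ShortExact
  hereditary : ∀ {X Y : 𝒟} (f : X ⟶ Y) [Mono f], torsion Y → torsion X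

namespace HereditaryTorsionTheory

variable {𝒟 : Type u} [Category.{v} 𝒟] [Abelian 𝒟] (τ : HereditaryTorsionTheory 𝒟)

/-- The torsion subobject `M_τ` of `M` (determined up to unique isomorphism). -/
def sub (M : 𝒟) : 𝒟 := (τ.exists_shortExact M).choose

/-- The torsion-free quotient `M / M_τ`. -/
def quot (M : 𝒟) : 𝒟 := (τ.exists_shortExact M).choose_spec.choose

/-- The inclusion of the torsion subobject `M_τ` in `M`. -/
def ι (M : 𝒟) : τ.sub M ⟶ M := (τ.exists_shortExact M).choose_spec.choose_spec.choose

/-- The canonical epimorphism `M ⟶ M / M_τ`. -/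
def π (M : 𝒟) : M ⟶ τ.quot M :=
  (τ.exists_shortExact M).choose_spec.choose_spec.choose_spec.choose

theorem exists_spec (M : 𝒟) : ∃ w : τ.ι M ≫ τ.π M = 0,
    τ.torsion (τ.sub M) ∧ τ.torsionFree (τ.quot M) ∧
      (ShortComplex.mk (τ.ι M) (τ.π M) w).ShortExact :=
  (τ.exists_shortExact M).choose_spec.choose_spec.choose_spec.choose_spec

theorem torsion_sub (M : 𝒟) : τ.torsion (τ.sub M) := (τ.exists_spec M).choose_spec.1

theorem torsionFree_quot (M : 𝒟) : τ.torsionFree (τ.quot M) := (τ.exists_spec M).choose_spec.2.1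

theorem ι_π (M : 𝒟) : τ.ι M ≫ τ.π M = 0 := (τ.exists_spec M).choose

theorem shortExact (M : 𝒟) : (ShortComplex.mk (τ.ι M) (τ.π M) (τ.ι_π M)).ShortExact :=
  (τ.exists_spec M).choose_spec.2.2

instance (M : 𝒟) : Mono (τ.ι M) := (τ.shortExact M).mono_f

instance (M : 𝒟) : Epi (τ.π M) := (τ.shortExact M).epi_g

theorem exists_lift {X M : 𝒟} (g : X ⟶ M) (hg : g ≫ τ.π M = 0) : ∃ k, k ≫ τ.ι M = g :=
  ⟨(τ.shortExact M).exact.lift g hg, (τ.shortExact M).exact.lift_f g hg⟩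

theorem torsion_of_hom {X : 𝒟} (h : ∀ Y, τ.torsionFree Y → ∀ f : X ⟶ Y, f = 0) :
    τ.torsion X := by
  obtain ⟨k, hk⟩ := τ.exists_lift (𝟙 X) (by rw [h _ (τ.torsionFree_quot X) (τ.π X), comp_zero])
  have : Mono k := mono_of_mono_fac hk
  exact τ.hereditary k (τ.torsion_sub X)

theorem torsion_of_epi {X Y : 𝒟} (f : X ⟶ Y) [Epi f] (hX : τ.torsion X) : τ.torsion Y :=
  τ.torsion_of_hom fun Z hZ g => by
    rw [← cancel_epi f, τ.hom_eq_zero hX hZ (f ≫ g), comp_zero]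

theorem torsion_biprod {X Y : 𝒟} (hX : τ.torsion X) (hY : τ.torsion Y) : τ.torsion (X ⊞ Y) :=
  τ.torsion_of_hom fun Z hZ g => by
    ext
    · rw [τ.hom_eq_zero hX hZ (biprod.inl ≫ g), comp_zero]
    · rw [τ.hom_eq_zero hY hZ (biprod.inr ≫ g), comp_zero]

theorem exists_lift_of_torsion {X M : 𝒟} (hX : τ.torsion X) (g : X ⟶ M) :
    ∃ k, k ≫ τ.ι M = g :=
  τ.exists_lift g (τ.hom_eq_zero hX (τ.torsionFree_quot M) _)

/-- The Gabriel filter of `τ` on `X`: the subobjects `I` of `X` with `X / I` torsion. -/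
def gabriel (X : 𝒟) : Set (Subobject X) := {I | τ.torsion (cokernel I.arrow)}

theorem top_mem_gabriel (X : 𝒟) : (⊤ : Subobject X) ∈ τ.gabriel X :=
  τ.torsion_of_hom fun Y _ f => by
    rw [← cancel_epi (cokernel.π (⊤ : Subobject X).arrow),
      ← cancel_epi (⊤ : Subobject X).arrow, cokernel.condition_assoc, zero_comp, comp_zero,
      comp_zero]

theorem kernelSubobject_mem_gabriel {X Y : 𝒟} (f : X ⟶ Y) (hY : τ.torsion Y) :
    kernelSubobject f ∈ τ.gabriel X := by
  have h : τ.torsion (Abelian.coimage f) := τ.hereditary (Abelian.factorThruCoimage f) hY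
  have w : (kernelSubobject f).arrow ≫ Abelian.coimage.π f = 0 := by
    rw [← kernelSubobject_arrow f, Category.assoc, cokernel.condition, comp_zero]
  have w' : kernel.ι f ≫ cokernel.π (kernelSubobject f).arrow = 0 := by
    rw [← kernelSubobject_arrow' f, Category.assoc, cokernel.condition, comp_zero]
  have e : Epi (cokernel.desc (kernel.ι f) _ w') :=
    epi_of_epi_fac (cokernel.π_desc (kernel.ι f) _ w')
  exact τ.torsion_of_epi (cokernel.desc (kernel.ι f) _ w') h

theorem eq_zero_of_gabriel {X Y : 𝒟} {I : Subobject X} (hI : I ∈ τ.gabriel X)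
    (hY : τ.torsionFree Y) (g : X ⟶ Y) (hg : I.arrow ≫ g = 0) : g = 0 := by
  rw [← cokernel.π_desc I.arrow g hg, τ.hom_eq_zero hI hY (cokernel.desc I.arrow g hg), comp_zero]

/-- The Gabriel filter on `X`, ordered by reverse inclusion. -/
abbrev GabrielIndex (X : 𝒟) : Type _ := (τ.gabriel X)ᵒᵈ

instance (X : 𝒟) : Nonempty (τ.GabrielIndex X) :=
  ⟨OrderDual.toDual ⟨⊤, τ.top_mem_gabriel X⟩⟩

instance (X : 𝒟) : IsDirectedOrder (τ.GabrielIndex X) := ⟨fun I J => by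
  let φ := biprod.lift (cokernel.π (OrderDual.ofDual I).1.arrow)
    (cokernel.π (OrderDual.ofDual J).1.arrow)
  refine ⟨OrderDual.toDual ⟨kernelSubobject φ,
    τ.kernelSubobject_mem_gabriel φ (τ.torsion_biprod (OrderDual.ofDual I).2
      (OrderDual.ofDual J).2)⟩, ?_, ?_⟩
  · change kernelSubobject φ ≤ (OrderDual.ofDual I).1
    refine Subobject.le_of_comm (Abelian.monoLift (OrderDual.ofDual I).1.arrow
      (kernelSubobject φ).arrow ?_) (Abelian.monoLift_comp _ _ _)
    have := kernelSubobject_arrow_comp φ =≫ biprod.fst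
    rw [Category.assoc, biprod.lift_fst, zero_comp] at this
    exact this
  · change kernelSubobject φ ≤ (OrderDual.ofDual J).1
    refine Subobject.le_of_comm (Abelian.monoLift (OrderDual.ofDual J).1.arrow
      (kernelSubobject φ).arrow ?_) (Abelian.monoLift_comp _ _ _)
    have := kernelSubobject_arrow_comp φ =≫ biprod.snd
    rw [Category.assoc, biprod.lift_snd, zero_comp] at this
    exact this⟩

/-- For `J ⊆ I` in the Gabriel filter on `X`, the restriction map `Hom(I, N) → Hom(J, N)`. -/
def restrict (X N : 𝒟) (I J : τ.GabrielIndex X) (h : I ≤ J) :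
    (((OrderDual.ofDual I).1 : 𝒟) ⟶ N) →+ (((OrderDual.ofDual J).1 : 𝒟) ⟶ N) :=
  Preadditive.leftComp N (Subobject.ofLE (OrderDual.ofDual J).1 (OrderDual.ofDual I).1 h)

open Classical in
/-- The abelian group `colim Hom(I, N)`, where `I` runs through the Gabriel filter on `X`. -/
abbrev ColimHom (X N : 𝒟) : Type _ :=
  AddCommGroup.DirectLimit
    (fun I : τ.GabrielIndex X => (((OrderDual.ofDual I).1 : 𝒟) ⟶ N)) (τ.restrict X N)

open Classical in
/-- The class in `colim Hom(I, N)` of a morphism `f : I ⟶ N`. -/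
def germ {X N : 𝒟} (I : Subobject X) (hI : I ∈ τ.gabriel X) (f : (I : 𝒟) ⟶ N) :
    τ.ColimHom X N :=
  AddCommGroup.DirectLimit.of
    (fun I : τ.GabrielIndex X => (((OrderDual.ofDual I).1 : 𝒟) ⟶ N)) (τ.restrict X N)
    (OrderDual.toDual ⟨I, hI⟩) f

/-- A module of quotients `Q` of `M`, relative to a family of objects `P i`: on each `P i` it is
`Hom(P i, Q) = colim Hom(I, M / M_τ)`, where `I` runs through the Gabriel filter on `P i`.
`homEquiv_naturality` says that a morphism `g : P i ⟶ P j` sends the class of `f : I ⟶ M / M_τ` to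
the class of `J ⟶ I ⟶ M / M_τ`, for any member `J` of the Gabriel filter that `g` maps into `I`.
`comp_Φ` says that `Φ : M ⟶ Q` sends `g : P i ⟶ M` to the class of `P i ⟶ M ⟶ M / M_τ`.
An object with these properties is constructed in `moduleOfQuotients` below. -/
structure ModuleOfQuotients {Λ : Type w} (P : Λ → 𝒟) (M : 𝒟) where
  obj : 𝒟
  Φ : M ⟶ obj
  homEquiv : ∀ i : Λ, τ.ColimHom (P i) (τ.quot M) ≃+ (P i ⟶ obj)
  homEquiv_naturality : ∀ {i j : Λ} (g : P i ⟶ P j) {I : Subobject (P j)} {J : Subobject (P i)}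
    (hI : I ∈ τ.gabriel (P j)) (hJ : J ∈ τ.gabriel (P i)) (h : (J : 𝒟) ⟶ (I : 𝒟)),
    h ≫ I.arrow = J.arrow ≫ g → ∀ f : (I : 𝒟) ⟶ τ.quot M,
      homEquiv i (τ.germ J hJ (h ≫ f)) = g ≫ homEquiv j (τ.germ I hI f)
  comp_Φ : ∀ {i : Λ} (g : P i ⟶ M),
    g ≫ Φ = homEquiv i (τ.germ ⊤ (τ.top_mem_gabriel (P i)) (Subobject.arrow ⊤ ≫ g ≫ τ.π M))

section Construction

variable [EnoughInjectives 𝒟] (M : 𝒟)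

/-- An embedding `M / M_τ ⟶ E` in an injective object. -/
abbrev qj : τ.quot M ⟶ Injective.under (τ.quot M) := Injective.ι (τ.quot M)

/-- The subobject `R` of `E` that contains `M / M_τ`, with `R / (M / M_τ)` the torsion subobject of
`E / (M / M_τ)`. -/
abbrev preQuotient : 𝒟 := pullback (cokernel.π (τ.qj M)) (τ.ι (cokernel (τ.qj M)))

/-- The inclusion `M / M_τ ⟶ R`. -/
abbrev toPre : τ.quot M ⟶ τ.preQuotient M :=
  pullback.lift (τ.qj M) 0 (by rw [cokernel.condition, zero_comp])

/-- The quotient `R / R_τ`. -/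
abbrev quotientObj : 𝒟 := τ.quot (τ.preQuotient M)

/-- The morphism `M / M_τ ⟶ R / R_τ`. -/
abbrev quotientMap : τ.quot M ⟶ τ.quotientObj M := τ.toPre M ≫ τ.π (τ.preQuotient M)

instance quotientMap_mono : Mono (τ.quotientMap M) := by
  have : Mono (τ.toPre M) :=
    mono_of_mono_fac (h := τ.qj M) (pullback.lift_fst _ _ _)
  obtain ⟨s, hs⟩ := τ.exists_lift (kernel.ι (τ.quotientMap M) ≫ τ.toPre M)
    (by rw [Category.assoc]; exact kernel.condition _)
  have : Mono s := by
    have : Mono (s ≫ τ.ι (τ.preQuotient M)) := by rw [hs]; infer_instance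
    exact mono_of_mono s (τ.ι (τ.preQuotient M))
  have h0 : kernel.ι (τ.quotientMap M) = 0 :=
    τ.hom_eq_zero (τ.hereditary s (τ.torsion_sub _)) (τ.torsionFree_quot M) _
  refine Preadditive.mono_of_cancel_zero _ fun {K} g hg => ?_
  rw [← kernel.lift_ι (τ.quotientMap M) g hg, h0, comp_zero]

theorem torsion_cokernel_quotientMap : τ.torsion (cokernel (τ.quotientMap M)) := by
  let a : τ.preQuotient M ⟶ τ.sub (cokernel (τ.qj M)) := pullback.snd _ _
  let b : τ.preQuotient M ⟶ cokernel (τ.quotientMap M) :=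
    τ.π (τ.preQuotient M) ≫ cokernel.π (τ.quotientMap M)
  have hmb : τ.toPre M ≫ b = 0 := by
    rw [← Category.assoc]; exact cokernel.condition (τ.quotientMap M)
  have hk : kernel.ι a ≫ b = 0 := by
    have h1 : (kernel.ι a ≫ pullback.fst _ _) ≫ cokernel.π (τ.qj M) = 0 := by
      rw [Category.assoc, pullback.condition, ← Category.assoc]
      change (kernel.ι a ≫ a) ≫ _ = 0
      rw [kernel.condition, zero_comp]
    have h2 : kernel.ι a = Abelian.monoLift (τ.qj M) _ h1 ≫ τ.toPre M := by
      apply pullback.hom_ext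
      · rw [Category.assoc, pullback.lift_fst, Abelian.monoLift_comp]
      · rw [Category.assoc, pullback.lift_snd, comp_zero]
        exact kernel.condition a
    rw [h2, Category.assoc, hmb, comp_zero]
  have hfac : a ≫ Abelian.epiDesc a b hk = b := Abelian.comp_epiDesc a b hk
  have : Epi (Abelian.epiDesc a b hk) := epi_of_epi_fac hfac
  exact τ.torsion_of_epi (Abelian.epiDesc a b hk) (τ.torsion_sub _)

theorem exists_extension {X : 𝒟} (I : Subobject X) (hI : I ∈ τ.gabriel X)
    (f : (I : 𝒟) ⟶ τ.quot M) :
    ∃ q : X ⟶ τ.quotientObj M, I.arrow ≫ q = f ≫ τ.quotientMap M := by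
  let e : X ⟶ Injective.under (τ.quot M) := Injective.factorThru (f ≫ τ.qj M) I.arrow
  have he : I.arrow ≫ e = f ≫ τ.qj M := Injective.comp_factorThru _ _
  have h0 : I.arrow ≫ e ≫ cokernel.π (τ.qj M) = 0 := by
    rw [← Category.assoc, he, Category.assoc, cokernel.condition, comp_zero]
  obtain ⟨s, hs⟩ := τ.exists_lift_of_torsion hI (cokernel.desc I.arrow _ h0)
  have hs' : e ≫ cokernel.π (τ.qj M) = (cokernel.π I.arrow ≫ s) ≫ τ.ι _ := by
    rw [Category.assoc, hs, cokernel.π_desc]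
  refine ⟨pullback.lift e (cokernel.π I.arrow ≫ s) hs' ≫ τ.π (τ.preQuotient M), ?_⟩
  rw [← Category.assoc, ← Category.assoc]
  congr 1
  apply pullback.hom_ext
  · rw [Category.assoc, pullback.lift_fst, Category.assoc, pullback.lift_fst, he]
  · rw [Category.assoc, pullback.lift_snd, Category.assoc, pullback.lift_snd,
      cokernel.condition_assoc, zero_comp, comp_zero]

theorem extension_unique {X : 𝒟} (I : Subobject X) (hI : I ∈ τ.gabriel X)
    {q q' : X ⟶ τ.quotientObj M} (h : I.arrow ≫ q = I.arrow ≫ q') : q = q' := by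
  rw [← sub_eq_zero]
  refine τ.eq_zero_of_gabriel hI (τ.torsionFree_quot _) _ ?_
  rw [Preadditive.comp_sub, h, sub_self]

/-- The unique morphism `X ⟶ R / R_τ` that extends `f : I ⟶ M / M_τ`. -/
def extend {X : 𝒟} (I : Subobject X) (hI : I ∈ τ.gabriel X) (f : (I : 𝒟) ⟶ τ.quot M) :
    X ⟶ τ.quotientObj M :=
  (τ.exists_extension M I hI f).choose

theorem arrow_extend {X : 𝒟} (I : Subobject X) (hI : I ∈ τ.gabriel X)
    (f : (I : 𝒟) ⟶ τ.quot M) : I.arrow ≫ τ.extend M I hI f = f ≫ τ.quotientMap M :=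
  (τ.exists_extension M I hI f).choose_spec

theorem extend_ofLE {X : 𝒟} {I J : Subobject X} (hI : I ∈ τ.gabriel X) (hJ : J ∈ τ.gabriel X)
    (h : J ≤ I) (f : (I : 𝒟) ⟶ τ.quot M) :
    τ.extend M J hJ (Subobject.ofLE J I h ≫ f) = τ.extend M I hI f := by
  refine τ.extension_unique M J hJ ?_
  rw [arrow_extend, ← Subobject.ofLE_arrow h, Category.assoc, Category.assoc, arrow_extend]

open Classical in
/-- The map `colim Hom(I, M / M_τ) → Hom(X, R / R_τ)` given by extension of morphisms. -/
def colimToHom (X : 𝒟) : τ.ColimHom X (τ.quot M) →+ (X ⟶ τ.quotientObj M) :=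
  AddCommGroup.DirectLimit.lift _ _ _
    (fun I => AddMonoidHom.mk' (τ.extend M (OrderDual.ofDual I).1 (OrderDual.ofDual I).2)
      fun f g => τ.extension_unique M _ (OrderDual.ofDual I).2 (by
        rw [Preadditive.comp_add, arrow_extend, arrow_extend, arrow_extend,
          Preadditive.add_comp]))
    (fun I J h f => τ.extend_ofLE M (OrderDual.ofDual I).2 (OrderDual.ofDual J).2 h f)

theorem colimToHom_germ {X : 𝒟} (I : Subobject X) (hI : I ∈ τ.gabriel X)
    (f : (I : 𝒟) ⟶ τ.quot M) : τ.colimToHom M X (τ.germ I hI f) = τ.extend M I hI f := by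
  classical
  exact AddCommGroup.DirectLimit.lift_of _ _ _ _ _

theorem arrow_colimToHom_germ {X : 𝒟} (I : Subobject X) (hI : I ∈ τ.gabriel X)
    (f : (I : 𝒟) ⟶ τ.quot M) :
    I.arrow ≫ τ.colimToHom M X (τ.germ I hI f) = f ≫ τ.quotientMap M := by
  rw [colimToHom_germ, arrow_extend]

theorem colimToHom_bijective (X : 𝒟) : Function.Bijective (τ.colimToHom M X) := by
  classical
  constructor
  · unfold colimToHom
    apply AddCommGroup.DirectLimit.lift_injective
    intro I f g h
    rw [← cancel_mono (τ.quotientMap M), ← arrow_extend τ M _ (OrderDual.ofDual I).2,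
      ← arrow_extend τ M _ (OrderDual.ofDual I).2]
    exact congrArg _ h
  · intro q
    let φ := q ≫ cokernel.π (τ.quotientMap M)
    have hI := τ.kernelSubobject_mem_gabriel φ (τ.torsion_cokernel_quotientMap M)
    have h0 : ((kernelSubobject φ).arrow ≫ q) ≫ cokernel.π (τ.quotientMap M) = 0 := by
      rw [Category.assoc]; exact kernelSubobject_arrow_comp φ
    refine ⟨τ.germ _ hI (Abelian.monoLift (τ.quotientMap M) _ h0), ?_⟩
    refine τ.extension_unique M _ hI ?_
    rw [arrow_colimToHom_germ, Abelian.monoLift_comp]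

/-- The module of quotients `Q_τ(M)`, together with `Φ : M ⟶ Q_τ(M)` and the isomorphisms
`colim Hom(I, M / M_τ) ≃ Hom(P i, Q_τ(M))`. -/
def moduleOfQuotients {Λ : Type w} (P : Λ → 𝒟) : τ.ModuleOfQuotients P M where
  obj := τ.quotientObj M
  Φ := τ.π M ≫ τ.quotientMap M
  homEquiv i := AddEquiv.ofBijective (τ.colimToHom M (P i)) (τ.colimToHom_bijective M (P i))
  homEquiv_naturality {i j} g I J hI hJ h hh f := by
    change τ.colimToHom M (P i) _ = g ≫ τ.colimToHom M (P j) _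
    refine τ.extension_unique M _ hJ ?_
    rw [arrow_colimToHom_germ, ← Category.assoc J.arrow, ← hh, Category.assoc,
      Category.assoc, arrow_colimToHom_germ]
  comp_Φ {i} g := by
    change _ = τ.colimToHom M (P i) _
    refine τ.extension_unique M _ (τ.top_mem_gabriel _) ?_
    rw [arrow_colimToHom_germ, Category.assoc, Category.assoc]

end Construction
end HereditaryTorsionTheory

end TorsionTheories

section HigherDerivations

/-- `X` is finitely generated: if `X` is the sum of a directed family of subobjects, then one of
them is `X`. -/
def IsFinitelyGenerated {C : Type u} [Category.{v} C] (X : C) : Prop :=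
  ∀ S : Set (Subobject X), S.Nonempty → DirectedOn (· ≤ ·) S → IsLUB S ⊤ → ⊤ ∈ S

/-- The natural transformations `Δ 0, …, Δ n` form a higher derivation of order `n` on the monad
`T`. (The values `Δ k` with `k > n` play no role, here and below.) -/
structure IsHigherDerivation {C : Type u} [Category.{v} C] [Preadditive C] (T : Monad C) (n : ℕ)
    (Δ : ℕ → ((T : C ⥤ C) ⟶ (T : C ⥤ C))) : Prop where
  zero : Δ 0 = 𝟙 (T : C ⥤ C)
  leibniz : ∀ k ≤ n, ∀ X : C, T.μ.app X ≫ (Δ k).app X =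
    (∑ p ∈ Finset.HasAntidiagonal.antidiagonal k, (Δ p.1 ◫ Δ p.2).app X) ≫ T.μ.app X

/-- The morphisms `D 0, …, D n` of the underlying category form a higher `Δ`-derivation of order
`n` on the `T`-module `M`. -/
structure IsHigherModuleDerivation {C : Type u} [Category.{v} C] [Preadditive C] {T : Monad C}
    (n : ℕ) (Δ : ℕ → ((T : C ⥤ C) ⟶ (T : C ⥤ C))) (M : T.Algebra) (D : ℕ → (M.A ⟶ M.A)) :
    Prop where
  zero : D 0 = 𝟙 M.A
  leibniz : ∀ k ≤ n, M.a ≫ D k =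
    (∑ p ∈ Finset.HasAntidiagonal.antidiagonal k, (Δ p.2).app M.A ≫ T.map (D p.1)) ≫ M.a

variable {C : Type u} [Category.{v} C] [Abelian C] {T : Monad C}
  [PreservesFiniteLimits T.toFunctor] [PreservesFiniteColimits T.toFunctor]

/-- `τ` is higher differential of order `n`: every higher `Δ`-derivation of order `n` on a module `N`
maps the torsion submodule `N_τ` into itself. -/
def IsHigherDifferential (n : ℕ) (Δ : ℕ → ((T : C ⥤ C) ⟶ (T : C ⥤ C)))
    (τ : HereditaryTorsionTheory T.Algebra) : Prop :=
  ∀ (N : T.Algebra) (D : ℕ → (N.A ⟶ N.A)), IsHigherModuleDerivation n Δ N D →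
    ∀ k ≤ n, ∃ d : (τ.sub N).A ⟶ (τ.sub N).A, (τ.ι N).f ≫ D k = d ≫ (τ.ι N).f

/-- Let `K' ⊆ K ⊆ I` be submodules of `TX` such that each `Δ j` maps `K'` into `K`, as the morphism
`δ j`. The morphisms of `T`-modules `h 0, …, h n : K ⟶ M` satisfy `h 0 = f` on `K` and
`h k = D k ∘ f - f ∘ Δ k - ∑ h t ∘ Δ j` on `K'`, the sum over `t + j = k` with `t, j > 0`. -/
structure SatisfiesRecursion (n : ℕ) (Δ : ℕ → ((T : C ⥤ C) ⟶ (T : C ⥤ C))) {M : T.Algebra}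
    (D : ℕ → (M.A ⟶ M.A)) {X : C} {I K K' : Subobject (T.free.obj X)} (hKI : K ≤ I)
    (hK'K : K' ≤ K) (δ : ℕ → ((K' : T.Algebra).A ⟶ (K : T.Algebra).A))
    (f : (I : T.Algebra) ⟶ M) (h : ℕ → ((K : T.Algebra) ⟶ M)) : Prop where
  comm : ∀ j ≤ n, δ j ≫ K.arrow.f = K'.arrow.f ≫ (Δ j).app X
  zero : h 0 = Subobject.ofLE K I hKI ≫ f
  succ : ∀ k, 1 ≤ k → k ≤ n → (Subobject.ofLE K' K hK'K).f ≫ (h k).f =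
    (Subobject.ofLE K' I (hK'K.trans hKI)).f ≫ f.f ≫ D k -
      δ k ≫ (Subobject.ofLE K I hKI).f ≫ f.f -
      ∑ p ∈ Finset.HasAntidiagonal.antidiagonal k with 0 < p.1 ∧ 0 < p.2, δ p.2 ≫ (h p.1).f

/-- The morphisms `h 0, …, h n : K ⟶ M` satisfy the recursion that defines `D̃ k f`, started at
`f : I ⟶ M`, on some member `K'` of the Gabriel filter on `TX`. -/
def IsLocalLift (n : ℕ) (Δ : ℕ → ((T : C ⥤ C) ⟶ (T : C ⥤ C)))
    (τ : HereditaryTorsionTheory T.Algebra) {M : T.Algebra} (D : ℕ → (M.A ⟶ M.A)) {X : C}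
    {I : Subobject (T.free.obj X)} (f : (I : T.Algebra) ⟶ M) {K : Subobject (T.free.obj X)}
    (h : ℕ → ((K : T.Algebra) ⟶ M)) : Prop :=
  ∃ (hKI : K ≤ I) (K' : Subobject (T.free.obj X)) (hK'K : K' ≤ K)
    (δ : ℕ → ((K' : T.Algebra).A ⟶ (K : T.Algebra).A)),
    K' ∈ τ.gabriel (T.free.obj X) ∧ SatisfiesRecursion n Δ D hKI hK'K δ f h

/-- The family of free modules `T(G i)`. -/
abbrev freeFamily (T : Monad C) {Λ : Type w} (G : Λ → C) (i : Λ) : T.Algebra := T.free.obj (G i)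

/-- The action of a morphism `E : N ⟶ N` of the underlying category on `Hom(TX, N) = Hom(X, N)`. -/
def mapFree {X : C} {N : T.Algebra} (E : N.A ⟶ N.A) (q : T.free.obj X ⟶ N) : T.free.obj X ⟶ N :=
  (T.adj.homEquiv X N).symm (T.adj.homEquiv X N q ≫ E)

variable {τ : HereditaryTorsionTheory T.Algebra}

/-- The morphism `T(G i) ⟶ Q`, that is, the element of `Q(T(G i))`, represented by `f : I ⟶ M`. -/
def cls {Λ : Type w} {G : Λ → C} {M : T.Algebra}
    (Q : τ.ModuleOfQuotients (freeFamily T G) M) {i : Λ} {I : Subobject (T.free.obj (G i))}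
    (hI : I ∈ τ.gabriel (T.free.obj (G i))) (f : (I : T.Algebra) ⟶ M) :
    T.free.obj (G i) ⟶ Q.obj :=
  Q.homEquiv i (τ.germ I hI (f ≫ τ.π M))

/-- The morphisms `E 0, …, E n` of the underlying category are the maps `D̃ k` on `Q`: for every
`f : I ⟶ M` and every solution `h` of the recursion started at `f`, the map `E k` sends the
element represented by `f` to the element represented by `h k`. -/
def IsInducedFamily (n : ℕ) (Δ : ℕ → ((T : C ⥤ C) ⟶ (T : C ⥤ C))) {Λ : Type w} {G : Λ → C}
    {M : T.Algebra} (D : ℕ → (M.A ⟶ M.A)) (Q : τ.ModuleOfQuotients (freeFamily T G) M)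
    (E : ℕ → (Q.obj.A ⟶ Q.obj.A)) : Prop :=
  ∀ (i : Λ) (I K : Subobject (T.free.obj (G i))) (hI : I ∈ τ.gabriel (T.free.obj (G i)))
    (hK : K ∈ τ.gabriel (T.free.obj (G i))) (f : (I : T.Algebra) ⟶ M)
    (h : ℕ → ((K : T.Algebra) ⟶ M)), IsLocalLift n Δ τ D f h →
      ∀ k ≤ n, mapFree (E k) (cls Q hI f) = cls Q hK (h k)

/-- The module of quotients `Q_τ(M)` of a module over an exact and colimit preserving monad on a
Grothendieck category, relative to the family `T(G i)`. -/
def quotientModule {C : Type u} [Category.{v} C] [Abelian C] [IsGrothendieckAbelian.{v} C]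
    {T : Monad C} [PreservesFiniteLimits T.toFunctor] [PreservesColimits T.toFunctor]
    (τ : HereditaryTorsionTheory T.Algebra) {Λ : Type w} (G : Λ → C) (M : T.Algebra) :
    τ.ModuleOfQuotients (freeFamily T G) M :=
  τ.moduleOfQuotients M (freeFamily T G)

end HigherDerivations
end

end HigherDer

open HigherDer

/-! Let J(N) be the module of polynomials over N truncated at t^(n+1), with T acting through ∑ Δ_j
t^j. A higher Δ-derivation on N is the same as a T-linear map N → J(N) with constant term 1, so a
family of non-linear maps becomes one morphism of modules (`jet`). The powers of t make J(N) an
iterated extension of copies of N (`jet.shortExact`). Hence being torsion, receiving no map from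
torsion, and extending maps along monomorphisms with torsion cokernel all pass from N to J(N)
(`jet.induction`).

Since M is torsion-free, Φ : M → Q is a monomorphism with torsion cokernel, and Q is separated and
closed; so is J(Q). The T-linear map M → J(Q) with coefficients Φ D_k therefore extends uniquely
along Φ, and the coefficients of the extension are the D̃_k (`exists_derivation`). This gives (3)
and (4).

With all h_t on one side, the recursion reads ∑ h_t Δ_j = D_k f. For q : TX → Q let q_t be the
T-linear map that agrees with D̃_t q on generators. Then D̃_k q = ∑ q_t Δ_j (`comp_derivation`),
because Δ_j kills the unit for j > 0. If q extends f, the q_t restricted to a submodule that they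
all send into M solve the recursion (`exists_isLocalLift`). Conversely, a solution extends to maps
TX → Q that satisfy the same identity on K', hence on TX by separatedness, and evaluation on
generators identifies them with the q_t (`mapFree_of_isLocalLift`). Uniqueness follows because every
map TG_i → Q is a class and the G_i separate. -/

namespace HigherDer

noncomputable section

/-! ### Separated and closed objects of a torsion theory -/

namespace HereditaryTorsionTheory

variable {𝒟 : Type u} [Category.{v} 𝒟] [Abelian 𝒟] (τ : HereditaryTorsionTheory 𝒟)

/-- `N` receives no nonzero morphism from a torsion object. -/
def Separated (N : 𝒟) : Prop := ∀ X, τ.torsion X → ∀ f : X ⟶ N, f = 0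

/-- Morphisms to `N` extend along monomorphisms with torsion cokernel. -/
def Closed (N : 𝒟) : Prop := ∀ ⦃A B : 𝒟⦄ (m : A ⟶ B) [Mono m], τ.torsion (cokernel m) →
  ∀ f : A ⟶ N, ∃ g : B ⟶ N, m ≫ g = f

variable {τ}

theorem Separated.hom_ext {N A B : 𝒟} (hN : τ.Separated N) (m : A ⟶ B)
    (hm : τ.torsion (cokernel m)) {f g : B ⟶ N} (h : m ≫ f = m ≫ g) : f = g := by
  have w : m ≫ (f - g) = 0 := by rw [Preadditive.comp_sub, h, sub_self]
  rw [← sub_eq_zero, ← cokernel.π_desc m (f - g) w, hN _ hm (cokernel.desc m (f - g) w), comp_zero]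

/-- Torsion is detected by maps to torsion-free objects, so cokernels need not be computed. -/
theorem torsion_cokernel_of_hom {A B : 𝒟} (m : A ⟶ B)
    (h : ∀ Y, τ.torsionFree Y → ∀ f : B ⟶ Y, m ≫ f = 0 → f = 0) : τ.torsion (cokernel m) :=
  τ.torsion_of_hom fun Y hY f => by
    rw [← cancel_epi (cokernel.π m), comp_zero]
    exact h Y hY _ (by rw [cokernel.condition_assoc, zero_comp])

theorem eq_zero_of_torsion_cokernel {A B Y : 𝒟} (m : A ⟶ B) (hm : τ.torsion (cokernel m))
    (hY : τ.torsionFree Y) (f : B ⟶ Y) (h : m ≫ f = 0) : f = 0 := by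
  rw [← cokernel.π_desc m f h, τ.hom_eq_zero hm hY (cokernel.desc m f h), comp_zero]

theorem torsion_cokernel_comp {A B X : 𝒟} (f : A ⟶ B) (g : B ⟶ X)
    (hf : τ.torsion (cokernel f)) (hg : τ.torsion (cokernel g)) :
    τ.torsion (cokernel (f ≫ g)) :=
  torsion_cokernel_of_hom _ fun _ hY h w =>
    eq_zero_of_torsion_cokernel g hg hY h
      (eq_zero_of_torsion_cokernel f hf hY _ (by rwa [Category.assoc] at w))

theorem mk_mem_gabriel {A X : 𝒟} (m : A ⟶ X) [Mono m] (hm : τ.torsion (cokernel m)) :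
    Subobject.mk m ∈ τ.gabriel X :=
  torsion_cokernel_of_hom _ fun _ hY h w =>
    eq_zero_of_torsion_cokernel m hm hY h (by
      rw [← Subobject.underlyingIso_arrow m, Category.assoc, w, comp_zero])

theorem torsion_of_isZero {X : 𝒟} (h : IsZero X) : τ.torsion X :=
  τ.torsion_of_hom fun _ _ f => h.eq_zero_of_src f

theorem separated_of_isZero {X : 𝒟} (h : IsZero X) : τ.Separated X :=
  fun _ _ f => h.eq_zero_of_tgt f

theorem closed_of_isZero {X : 𝒟} (h : IsZero X) : τ.Closed X :=
  fun _ _ _ _ _ _ => ⟨0, h.eq_of_tgt _ _⟩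

theorem torsion_of_shortExact {S : ShortComplex 𝒟} (hS : S.ShortExact) (h₁ : τ.torsion S.X₁)
    (h₃ : τ.torsion S.X₃) : τ.torsion S.X₂ :=
  τ.torsion_of_hom fun Y hY f => by
    have := hS.epi_g
    have w := τ.hom_eq_zero h₁ hY (S.f ≫ f)
    rw [← hS.exact.g_desc f w, τ.hom_eq_zero h₃ hY (hS.exact.desc f w), comp_zero]

theorem separated_of_shortExact {S : ShortComplex 𝒟} (hS : S.ShortExact)
    (h₁ : τ.Separated S.X₁) (h₃ : τ.Separated S.X₃) : τ.Separated S.X₂ := fun X hX f => by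
  have := hS.mono_f
  have w : f ≫ S.g = 0 := h₃ X hX _
  rw [← hS.exact.lift_f f w, h₁ X hX (hS.exact.lift f w), zero_comp]

/-- Extend the image of `f` in `S.X₃` to `g`, and pull the extension back along `g`. The pullback is
an extension of `X` by `S.X₁` that splits over `I`; closedness of `S.X₁` spreads the splitting to
all of `X`. -/
theorem closed_of_shortExact {S : ShortComplex 𝒟} (hS : S.ShortExact)
    (h₁ : τ.Closed S.X₁) (h₃ : τ.Closed S.X₃) : τ.Closed S.X₂ := fun I X m _ hm f => by
  have := hS.mono_f
  have := hS.epi_g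
  obtain ⟨g, hg⟩ := h₃ m hm (f ≫ S.g)
  let u : pullback g S.g ⟶ X := pullback.fst g S.g
  let s : I ⟶ pullback g S.g := pullback.lift m f hg
  let a : S.X₁ ⟶ pullback g S.g := pullback.lift 0 S.f (by rw [zero_comp, S.zero])
  have su : s ≫ u = m := pullback.lift_fst _ _ _
  have au : a ≫ u = 0 := pullback.lift_fst _ _ _
  have asnd : a ≫ pullback.snd g S.g = S.f := pullback.lift_snd _ _ _
  have ssnd : s ≫ pullback.snd g S.g = f := pullback.lift_snd _ _ _
  have : Mono s := mono_of_mono_fac su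
  have : Mono a := mono_of_mono_fac asnd
  -- `u` is the cokernel of `a`: it is epi and its kernel is `S.X₁`.
  have hu : ∀ {Z : 𝒟} (t : pullback g S.g ⟶ Z), a ≫ t = 0 → ∃ t', u ≫ t' = t := by
    intro Z t ht
    have hk : (kernel.ι u ≫ pullback.snd g S.g) ≫ S.g = 0 := by
      rw [Category.assoc, ← pullback.condition, ← Category.assoc, kernel.condition, zero_comp]
    have hl : kernel.ι u = hS.exact.lift _ hk ≫ a := by
      apply pullback.hom_ext
      · exact (kernel.condition u).trans (by rw [Category.assoc]; exact (by rw [au, comp_zero]))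
      · rw [Category.assoc, asnd, hS.exact.lift_f]
    exact ⟨Abelian.epiDesc u t (by rw [hl, Category.assoc, ht, comp_zero]),
      Abelian.comp_epiDesc _ _ _⟩
  -- `S.X₁` and `I` meet trivially in the pullback, because `I` embeds in `X`.
  have hmono : Mono (a ≫ cokernel.π s) := Preadditive.mono_of_cancel_zero _ fun {Z} x hx => by
    rw [← Category.assoc] at hx
    have hy := Abelian.monoLift_comp s (x ≫ a) hx
    have h0 : Abelian.monoLift s (x ≫ a) hx = 0 := by
      rw [← cancel_mono m, zero_comp, ← su, ← Category.assoc, hy, Category.assoc, au, comp_zero]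
    rw [← cancel_mono a, zero_comp, ← hy, h0, zero_comp]
  -- This cokernel is the pullback modulo `S.X₁ + I`, that is, `X / I`.
  have htor : τ.torsion (cokernel (a ≫ cokernel.π s)) :=
    torsion_cokernel_of_hom _ fun Y hY h w => by
      obtain ⟨t, ht⟩ := hu (cokernel.π s ≫ h) (by rwa [Category.assoc] at w)
      have : t = 0 := eq_zero_of_torsion_cokernel m hm hY t (by
        rw [← su, Category.assoc, ht, cokernel.condition_assoc, zero_comp])
      rw [← cancel_epi (cokernel.π s), ← ht, this, comp_zero, comp_zero]
  -- The extension of the identity of `S.X₁` is a retraction of the pullback onto `S.X₁` that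
  -- vanishes on `I`.
  obtain ⟨r, hr⟩ := h₁ (a ≫ cokernel.π s) htor (𝟙 _)
  rw [Category.assoc] at hr
  obtain ⟨σ, hσ⟩ := hu (𝟙 _ - (cokernel.π s ≫ r) ≫ a) (by
    rw [Preadditive.comp_sub, ← Category.assoc a, hr, Category.id_comp, Category.comp_id,
      sub_self])
  refine ⟨σ ≫ pullback.snd g S.g, ?_⟩
  rw [← su, Category.assoc, ← Category.assoc u, hσ, ← Category.assoc, Preadditive.comp_sub,
    Category.assoc (cokernel.π s), cokernel.condition_assoc, zero_comp, sub_zero,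
    Category.comp_id, ssnd]

variable (M : 𝒟)

theorem isIso_π (hM : τ.torsionFree M) : IsIso (τ.π M) := by
  have : Mono (τ.π M) := (τ.shortExact M).exact.mono_g
    (τ.hom_eq_zero (τ.torsion_sub M) hM _)
  exact isIso_of_mono_of_epi _

theorem torsion_cokernel_π : τ.torsion (cokernel (τ.π M)) :=
  torsion_cokernel_of_hom _ fun _ _ f h => by rwa [← cancel_epi (τ.π M), comp_zero]

variable [EnoughInjectives 𝒟]

/-- The part of `A` that `f` sends into `M / M_τ` has torsion quotient in `A`, hence in `B`. There
`exists_extension` applies, and the result agrees with `f` on all of `A` since the target is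
torsion-free. -/
theorem closed_quotientObj : τ.Closed (τ.quotientObj M) := fun A B m _ hm f => by
  let φ := f ≫ cokernel.π (τ.quotientMap M)
  have hK := τ.kernelSubobject_mem_gabriel φ (τ.torsion_cokernel_quotientMap M)
  have h0 : ((kernelSubobject φ).arrow ≫ f) ≫ cokernel.π (τ.quotientMap M) = 0 := by
    rw [Category.assoc]; exact kernelSubobject_arrow_comp φ
  let k := (kernelSubobject φ).arrow ≫ m
  obtain ⟨q, hq⟩ := τ.exists_extension M (Subobject.mk k)
    (mk_mem_gabriel k (torsion_cokernel_comp _ _ hK hm))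
    ((Subobject.underlyingIso k).hom ≫ Abelian.monoLift (τ.quotientMap M) _ h0)
  refine ⟨q, sub_eq_zero.1 (τ.eq_zero_of_gabriel hK (τ.torsionFree_quot _) _ ?_)⟩
  have hq' := (Subobject.underlyingIso k).inv ≫= hq
  rw [Category.assoc, Abelian.monoLift_comp, Iso.inv_hom_id_assoc, ← Category.assoc,
    Subobject.underlyingIso_arrow, Category.assoc] at hq'
  rw [Preadditive.comp_sub, hq', sub_self]

theorem separated_quotientObj : τ.Separated (τ.quotientObj M) :=
  fun _ hX f => τ.hom_eq_zero hX (τ.torsionFree_quot _) f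

end HereditaryTorsionTheory

/-! ### Convolution sums and finite powers -/

open Finset.HasAntidiagonal (antidiagonal)

/-- Both sides run over the triples of sum `k`. This is the associativity of multiplication of
polynomials. -/
theorem sum_antidiagonal_antidiagonal {A : Type*} [AddCommMonoid A] (k : ℕ)
    (F : ℕ → ℕ → ℕ → A) :
    ∑ p ∈ antidiagonal k, ∑ q ∈ antidiagonal p.2, F p.1 q.1 q.2 =
      ∑ p ∈ antidiagonal k, ∑ q ∈ antidiagonal p.1, F q.1 q.2 p.2 := by
  rw [Finset.sum_sigma', Finset.sum_sigma']
  refine Finset.sum_nbij' (fun x => ⟨(x.1.1 + x.2.1, x.2.2), (x.1.1, x.2.1)⟩)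
    (fun x => ⟨(x.2.1, x.2.2 + x.1.2), (x.2.2, x.1.2)⟩) ?_ ?_ ?_ ?_ ?_
  all_goals
    rintro ⟨⟨a, b⟩, ⟨c, d⟩⟩
    simp only [Finset.mem_sigma, Finset.HasAntidiagonal.mem_antidiagonal]
    rintro ⟨rfl, rfl⟩
    simp [add_assoc]

section Power

variable {C : Type u} [Category.{v} C] [Preadditive C] [HasFiniteProducts C]

/-- The product of `m` copies of `A`. -/
abbrev power (A : C) (m : ℕ) : C := ∏ᶜ fun _ : Fin m => A

/-- The `k`-th projection (zero if `m ≤ k`). -/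
def power.π (A : C) (m k : ℕ) : power A m ⟶ A :=
  if h : k < m then Pi.π (fun _ : Fin m => A) ⟨k, h⟩ else 0

/-- The morphism with components `f k`, for `k < m`. -/
def power.lift {A B : C} (m : ℕ) (f : ℕ → (B ⟶ A)) : B ⟶ power A m :=
  Pi.lift fun i : Fin m => f i

theorem power.lift_π {A B : C} {m : ℕ} (f : ℕ → (B ⟶ A)) {k : ℕ} (hk : k < m) :
    power.lift m f ≫ power.π A m k = f k := by
  simp [power.π, power.lift, hk]

theorem power.hom_ext {A B : C} {m : ℕ} {f g : B ⟶ power A m}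
    (h : ∀ k < m, f ≫ power.π A m k = g ≫ power.π A m k) : f = g := by
  refine Pi.hom_ext _ _ fun i => ?_
  have := h i i.2
  simpa [power.π] using this

end Power

/-! ### Higher derivations and the unit of the monad -/

section Unit

variable {C : Type u} [Category.{v} C] [Preadditive C] {T : Monad C} {n : ℕ}
  {Δ : ℕ → ((T : C ⥤ C) ⟶ (T : C ⥤ C))}

theorem IsHigherDerivation.zero_app (hΔ : IsHigherDerivation T n Δ) (X : C) :
    (Δ 0).app X = 𝟙 _ := by
  rw [hΔ.zero]; rfl

/-- The Leibniz rule for 1 = 1 · 1: by induction the inner terms vanish, and each end term is the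
value d at the unit, so d = d + d. -/
theorem IsHigherDerivation.η_comp [(T : C ⥤ C).Additive] (hΔ : IsHigherDerivation T n Δ) :
    ∀ k, 0 < k → k ≤ n → ∀ X : C, T.η.app X ≫ (Δ k).app X = 0 := by
  intro k
  induction k using Nat.strong_induction_on with
  | _ k ih =>
    intro hk hkn X
    have key := (T.η.app X ≫ T.η.app (T.obj X)) ≫= hΔ.leibniz k hkn X
    rw [Category.assoc, T.left_unit_assoc, ← Category.assoc, Preadditive.comp_sum,
      Finset.sum_eq_add (0, k) (k, 0) (by simp [hk.ne])] at key
    · have h₁ : (T.η.app X ≫ T.η.app (T.obj X)) ≫ (Δ 0 ◫ Δ k).app X ≫ T.μ.app X =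
          T.η.app X ≫ (Δ k).app X := by
        have := (T.η ≫ Δ k).naturality (T.η.app X)
        simp only [NatTrans.comp_app, Functor.id_map] at this
        rw [NatTrans.hcomp_app, hΔ.zero_app, CategoryTheory.Functor.map_id]
        erw [Category.comp_id]
        rw [← Category.assoc, Category.assoc (T.η.app X), this, Category.assoc]
        erw [T.right_unit, Category.comp_id]
        rfl
      have h₂ : (T.η.app X ≫ T.η.app (T.obj X)) ≫ (Δ k ◫ Δ 0).app X ≫ T.μ.app X =
          T.η.app X ≫ (Δ k).app X := by
        have := T.η.naturality ((Δ k).app X)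
        simp only [Functor.id_map] at this
        rw [NatTrans.hcomp_app, hΔ.zero_app]
        erw [Category.id_comp]
        rw [← Category.assoc, Category.assoc (T.η.app X), ← this, Category.assoc, Category.assoc,
          T.left_unit]
        erw [Category.comp_id]
      rw [Preadditive.add_comp] at key
      simp only [Category.assoc] at key h₁ h₂
      rw [h₁, h₂] at key
      exact left_eq_add.1 key
    · rintro ⟨a, b⟩ hab hne
      rw [Finset.HasAntidiagonal.mem_antidiagonal] at hab
      simp only [ne_eq, Prod.mk.injEq] at hne hab
      rw [NatTrans.hcomp_app]
      simp only [Category.assoc]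
      have := ih b (by omega) (by omega) (by omega) (T.obj X)
      rw [reassoc_of% this]
      simp
    · intro h; exact absurd (by simp) h
    · intro h; exact absurd (by simp) h

/-- Only the term with `Δ 0` survives on generators. -/
theorem η_convolution [(T : C ⥤ C).Additive] (hΔ : IsHigherDerivation T n Δ) {X Z : C} (u : ℕ → (T.obj X ⟶ Z)) {k : ℕ}
    (hk : k ≤ n) :
    T.η.app X ≫ ∑ p ∈ antidiagonal k, (Δ p.2).app X ≫ u p.1 = T.η.app X ≫ u k := by
  rw [Preadditive.comp_sum, Finset.sum_eq_single (k, 0)]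
  · rw [hΔ.zero_app]
    erw [Category.id_comp]
  · rintro ⟨i, j⟩ hij hne
    rw [Finset.HasAntidiagonal.mem_antidiagonal] at hij
    simp only [ne_eq, Prod.mk.injEq] at hij hne
    rw [← Category.assoc, hΔ.η_comp j (by omega) (by omega), zero_comp]
  · intro h; exact absurd (by simp) h

end Unit

/-! ### Jet modules -/

section Jets

variable {C : Type u} [Category.{v} C] [Abelian C] {T : Monad C}

/-- The morphisms `f 0, …, f (m - 1)` of the underlying category are the components of a morphism
from `Y` to the jet module of `N`. -/
def IsJetFamily (Δ : ℕ → ((T : C ⥤ C) ⟶ (T : C ⥤ C))) (m : ℕ) (Y N : T.Algebra)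
    (f : ℕ → (Y.A ⟶ N.A)) : Prop :=
  ∀ k < m, Y.a ≫ f k =
    ∑ p ∈ antidiagonal k, (Δ p.2).app Y.A ≫ T.map (f p.1) ≫ N.a

variable {n : ℕ} {Δ : ℕ → ((T : C ⥤ C) ⟶ (T : C ⥤ C))}

theorem isJetFamily_of_derivation {N : T.Algebra} {D : ℕ → (N.A ⟶ N.A)}
    (hD : IsHigherModuleDerivation n Δ N D) : IsJetFamily Δ (n + 1) N N D := fun k hk => by
  rw [hD.leibniz k (Nat.lt_succ_iff.1 hk), Preadditive.sum_comp]
  simp only [Category.assoc]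

theorem isJetFamily_free (hΔ : IsHigherDerivation T n Δ) (X : C) :
    IsJetFamily Δ (n + 1) (T.free.obj X) (T.free.obj X) (fun k => (Δ k).app X) := fun k hk => by
  refine (hΔ.leibniz k (Nat.lt_succ_iff.1 hk) X).trans ?_
  rw [Preadditive.sum_comp]
  refine Finset.sum_congr rfl fun p _ => ?_
  rw [NatTrans.hcomp_app, Category.assoc]
  rfl

theorem IsJetFamily.comp_hom {m : ℕ} {Y N N' : T.Algebra} {f : ℕ → (Y.A ⟶ N.A)}
    (hf : IsJetFamily Δ m Y N f) (g : N ⟶ N') :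
    IsJetFamily Δ m Y N' (fun k => f k ≫ g.f) := fun k hk => by
  rw [← Category.assoc, hf k hk, Preadditive.sum_comp]
  refine Finset.sum_congr rfl fun p _ => ?_
  simp only [Category.assoc, Functor.map_comp, g.h]

theorem IsJetFamily.hom_comp {m : ℕ} {Y Y' N : T.Algebra} {f : ℕ → (Y.A ⟶ N.A)}
    (hf : IsJetFamily Δ m Y N f) (g : Y' ⟶ Y) :
    IsJetFamily Δ m Y' N (fun k => g.f ≫ f k) := fun k hk => by
  rw [← Category.assoc, ← g.h, Category.assoc, hf k hk, Preadditive.comp_sum]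
  refine Finset.sum_congr rfl fun p _ => ?_
  rw [NatTrans.naturality_assoc, Functor.map_comp, Category.assoc]

variable [PreservesFiniteLimits T.toFunctor]

/-- This is composition with the polynomial `∑ g k t ^ k`; its coefficients are `T`-linear, so it
commutes with the twisted action. -/
theorem IsJetFamily.convolution {m : ℕ} {Y N N' : T.Algebra} {f : ℕ → (Y.A ⟶ N.A)}
    (hf : IsJetFamily Δ m Y N f) (g : ℕ → (N ⟶ N')) :
    IsJetFamily Δ m Y N' (fun k => ∑ p ∈ antidiagonal k, f p.2 ≫ (g p.1).f) := fun k hk => by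
  calc _ = ∑ p ∈ antidiagonal k, ∑ q ∈ antidiagonal p.2,
        (Δ q.2).app Y.A ≫ T.map (f q.1) ≫ T.map (g p.1).f ≫ N'.a := by
        rw [Preadditive.comp_sum]
        refine Finset.sum_congr rfl fun p hp => ?_
        have : p.2 < m := lt_of_le_of_lt (Finset.HasAntidiagonal.antidiagonal.snd_le hp) hk
        rw [← Category.assoc, hf _ this, Preadditive.sum_comp]
        refine Finset.sum_congr rfl fun q _ => ?_
        simp only [Category.assoc, (g p.1).h]
    _ = _ := by
        rw [sum_antidiagonal_antidiagonal k fun a b c =>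
          (Δ c).app Y.A ≫ T.map (f b) ≫ T.map (g a).f ≫ N'.a]
        refine Finset.sum_congr rfl fun p _ => ?_
        rw [Functor.map_sum, Preadditive.sum_comp, Preadditive.comp_sum]
        simp only [Functor.map_comp, Category.assoc]

/-- The module of truncated polynomials `∑ x k t ^ k`, `k < m`, with coefficients in `N`, on which
`T` acts through `∑ Δ k t ^ k`. -/
abbrev jet (hΔ : IsHigherDerivation T n Δ) (N : T.Algebra) (m : ℕ) (hm : m ≤ n + 1) : T.Algebra where
  A := power N.A m
  a := power.lift m fun k =>
    ∑ p ∈ antidiagonal k, (Δ p.2).app _ ≫ T.map (power.π N.A m p.1) ≫ N.a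
  -- The terms with `j > 0` vanish on the unit. The bound `m ≤ n + 1` keeps all indices in the range
  -- where `Δ` obeys the Leibniz rule.
  unit := power.hom_ext fun k hk => by
    rw [Category.assoc, power.lift_π _ hk, Category.id_comp (power.π N.A m k),
      Preadditive.comp_sum, Finset.sum_eq_single (k, 0)]
    · rw [hΔ.zero_app, Category.id_comp]
      rw [← T.η.naturality_assoc, N.unit]
      exact Category.comp_id _
    · rintro ⟨i, j⟩ hij hne
      rw [Finset.HasAntidiagonal.mem_antidiagonal] at hij
      have hj : 0 < j := by
        rcases Nat.eq_zero_or_pos j with rfl | h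
        · exact absurd (by simp at hij; rw [hij]) hne
        · exact h
      simp only at hij ⊢
      rw [← Category.assoc, hΔ.η_comp j hj (by omega), zero_comp]
    · intro h; exact absurd (by simp) h
  assoc := power.hom_ext fun k hk => by
    rw [Category.assoc, Category.assoc, power.lift_π _ hk, Preadditive.comp_sum,
      Preadditive.comp_sum]
    calc _ = ∑ p ∈ antidiagonal k, ∑ q ∈ antidiagonal p.2,
          (Δ q.2).app _ ≫ T.map ((Δ q.1).app _) ≫ T.map (T.map (power.π N.A m p.1)) ≫
            T.map N.a ≫ N.a := by
          refine Finset.sum_congr rfl fun p hp => ?_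
          have : p.2 ≤ n := by have := Finset.HasAntidiagonal.antidiagonal.snd_le hp; omega
          rw [← Category.assoc, hΔ.leibniz _ this, Preadditive.sum_comp, Preadditive.sum_comp]
          refine Finset.sum_congr rfl fun q _ => ?_
          rw [NatTrans.hcomp_app, Category.assoc, Category.assoc, ← N.assoc]
          erw [T.μ.naturality_assoc]
      _ = ∑ p ∈ antidiagonal k, ∑ q ∈ antidiagonal p.1,
          (Δ p.2).app _ ≫ T.map ((Δ q.2).app _) ≫ T.map (T.map (power.π N.A m q.1)) ≫
            T.map N.a ≫ N.a := 
          sum_antidiagonal_antidiagonal k fun a b c =>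
            (Δ c).app _ ≫ T.map ((Δ b).app _) ≫ T.map (T.map (power.π N.A m a)) ≫
            T.map N.a ≫ N.a
      _ = _ := by
          refine Finset.sum_congr rfl fun p hp => ?_
          have : p.1 < m := by have := Finset.HasAntidiagonal.antidiagonal.fst_le hp; omega
          rw [NatTrans.naturality_assoc, ← Functor.map_comp_assoc, power.lift_π _ this,
            Functor.map_sum, Preadditive.sum_comp, Preadditive.comp_sum]
          simp only [Functor.map_comp, Category.assoc]

variable (hΔ : IsHigherDerivation T n Δ) {m : ℕ} (hm : m ≤ n + 1)

theorem isJetFamily_π (N : T.Algebra) :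
    IsJetFamily Δ m (jet hΔ N m hm) N (fun k => power.π N.A m k) := fun _ hk =>
  power.lift_π (fun k => ∑ p ∈ antidiagonal k,
    (Δ p.2).app _ ≫ T.map (power.π N.A m p.1) ≫ N.a) hk

theorem isJetFamily_comp {Y N : T.Algebra} (g : Y ⟶ jet hΔ N m hm) :
    IsJetFamily Δ m Y N (fun k => g.f ≫ power.π N.A m k) :=
  (isJetFamily_π hΔ hm N).hom_comp g

/-- The morphism of modules with the components `f k`. -/
@[simps]
def jet.lift {Y N : T.Algebra} {f : ℕ → (Y.A ⟶ N.A)} (hf : IsJetFamily Δ m Y N f) :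
    Y ⟶ jet hΔ N m hm where
  f := power.lift m f
  h := power.hom_ext fun k hk => by
    rw [Category.assoc, Category.assoc, power.lift_π _ hk, power.lift_π f hk, hf k hk,
      Preadditive.comp_sum]
    refine Finset.sum_congr rfl fun p hp => ?_
    have : p.1 < m := lt_of_le_of_lt (Finset.HasAntidiagonal.antidiagonal.fst_le hp) hk
    rw [NatTrans.naturality_assoc, ← Functor.map_comp_assoc, power.lift_π _ this]

theorem jet.hom_ext {Y N : T.Algebra} {f g : Y ⟶ jet hΔ N m hm}
    (h : ∀ k < m, f.f ≫ power.π N.A m k = g.f ≫ power.π N.A m k) : f = g :=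
  Monad.Algebra.Hom.ext (power.hom_ext h)


theorem jet.lift_π {Y N : T.Algebra} {f : ℕ → (Y.A ⟶ N.A)} (hf : IsJetFamily Δ m Y N f) {k : ℕ}
    (hk : k < m) : (jet.lift hΔ hm hf).f ≫ power.π N.A m k = f k :=
  power.lift_π f hk

/-- Truncation of polynomials. -/
abbrev jet.truncate (N : T.Algebra) (hm' : m + 1 ≤ n + 1) :
    jet hΔ N (m + 1) hm' ⟶ jet hΔ N m hm :=
  jet.lift (f := fun k => power.π N.A (m + 1) k) hΔ hm fun k hk =>
    isJetFamily_π hΔ hm' N k (hk.trans (Nat.lt_succ_self m))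

theorem jet.truncate_π (N : T.Algebra) (hm' : m + 1 ≤ n + 1) {k : ℕ} (hk : k < m) :
    (jet.truncate hΔ hm N hm').f ≫ power.π N.A m k = power.π N.A (m + 1) k :=
  power.lift_π _ hk

/-- On multiples of `t ^ m` only `Δ 0` acts, since `t ^ (m + 1) = 0`; so the action there is
untwisted. -/
theorem isJetFamily_top (N : T.Algebra) (hΔ : IsHigherDerivation T n Δ) :
    IsJetFamily Δ (m + 1) N N (fun k => if k = m then 𝟙 N.A else 0) := fun k hk => by
  beta_reduce
  rcases eq_or_ne k m with rfl | hne
  · rw [Finset.sum_eq_single (k, 0)]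
    · rw [hΔ.zero_app, if_pos rfl, CategoryTheory.Functor.map_id, Category.comp_id]
      erw [Category.id_comp, Category.id_comp]
    · rintro ⟨i, j⟩ hij hne
      rw [Finset.HasAntidiagonal.mem_antidiagonal] at hij
      simp only [ne_eq, Prod.mk.injEq] at hij hne
      rw [if_neg (by omega), Functor.map_zero, zero_comp, comp_zero]
    · intro h; exact absurd (by simp) h
  · rw [if_neg hne, comp_zero, Finset.sum_eq_zero]
    intro p hp
    have := Finset.HasAntidiagonal.antidiagonal.fst_le hp
    rw [if_neg (by omega), Functor.map_zero, zero_comp, comp_zero]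

/-- The inclusion of `N` as the module of multiples of `t ^ m`. -/
abbrev jet.top (N : T.Algebra) (hm' : m + 1 ≤ n + 1) : N ⟶ jet hΔ N (m + 1) hm' :=
  jet.lift hΔ hm' (isJetFamily_top N hΔ)

theorem jet.top_π (N : T.Algebra) (hm' : m + 1 ≤ n + 1) {k : ℕ} (hk : k < m + 1) :
    (jet.top hΔ N hm').f ≫ power.π N.A (m + 1) k = if k = m then 𝟙 N.A else 0 :=
  power.lift_π (fun k => if k = m then 𝟙 N.A else 0) hk

theorem jet.exists_lift_top (N : T.Algebra) (hm' : m + 1 ≤ n + 1) {Z : T.Algebra}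
    (g : Z ⟶ jet hΔ N (m + 1) hm') (hz : ∀ k < m, g.f ≫ power.π N.A (m + 1) k = 0) :
    ∃ l, l ≫ jet.top hΔ N hm' = g := by
  refine ⟨{ f := g.f ≫ power.π N.A (m + 1) m, h := ?_ }, jet.hom_ext hΔ hm' fun k hk => ?_⟩
  -- The coefficient of `t ^ m` is `T`-linear, because each `Δ j` with `j > 0` meets a lower
  -- coefficient, which is zero.
  · have h := isJetFamily_comp hΔ hm' g m (Nat.lt_succ_self m)
    rw [Finset.sum_eq_single (m, 0)] at h
    · rw [hΔ.zero_app] at h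
      erw [Category.id_comp] at h
      exact h.symm
    · rintro ⟨i, j⟩ hij hne
      rw [Finset.HasAntidiagonal.mem_antidiagonal] at hij
      simp only [ne_eq, Prod.mk.injEq] at hij hne
      beta_reduce
      rw [hz i (by omega), Functor.map_zero, zero_comp, comp_zero]
    · intro h; exact absurd (by simp) h
  · rw [Monad.Algebra.comp_f, Category.assoc, jet.top_π hΔ N hm' hk]
    rcases eq_or_ne k m with rfl | hne
    · rw [if_pos rfl, Category.comp_id]
    · rw [if_neg hne, comp_zero, hz k (by omega)]

theorem zero_f (Y N : T.Algebra) : (0 : Y ⟶ N).f = 0 := rfl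

theorem jet.isZero (N : T.Algebra) (h0 : 0 ≤ n + 1) : IsZero (jet hΔ N 0 h0) := by
  rw [IsZero.iff_id_eq_zero]
  exact jet.hom_ext hΔ h0 fun k hk => absurd hk (Nat.not_lt_zero k)

theorem jet.top_truncate (N : T.Algebra) (hm' : m + 1 ≤ n + 1) :
    jet.top hΔ N hm' ≫ jet.truncate hΔ hm N hm' = 0 :=
  jet.hom_ext hΔ hm fun k hk => by
    rw [Monad.Algebra.comp_f, Category.assoc, jet.truncate_π hΔ hm N hm' hk,
      jet.top_π hΔ N hm' (hk.trans (Nat.lt_succ_self m)), if_neg hk.ne, zero_f, zero_comp]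

variable [PreservesFiniteColimits T.toFunctor]

/-- The sequence splits in the underlying category, though in general not `T`-linearly; mono and epi
are reflected by the forgetful functor. -/
theorem jet.shortExact (N : T.Algebra) (hm' : m + 1 ≤ n + 1) :
    (ShortComplex.mk _ _ (jet.top_truncate hΔ hm N hm')).ShortExact := by
  have hmono : Mono (jet.top hΔ N hm') := by
    have h : T.forget.map (jet.top hΔ N hm') ≫ power.π N.A (m + 1) m = 𝟙 N.A :=
      (jet.top_π hΔ N hm' (Nat.lt_succ_self m)).trans (if_pos rfl)
    have : Mono (T.forget.map (jet.top hΔ N hm') ≫ power.π N.A (m + 1) m) := by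
      rw [h]; exact inferInstanceAs (Mono (𝟙 N.A))
    exact T.forget.mono_of_mono_map (mono_of_mono _ (power.π N.A (m + 1) m))
  have hepi : Epi (jet.truncate hΔ hm N hm') := by
    -- The default value `power.π N.A m m = 0` makes this the section that pads with a zero top
    -- coefficient.
    have h : power.lift (m + 1) (fun k => power.π N.A m k) ≫
        (jet.truncate hΔ hm N hm').f = 𝟙 (power N.A m) :=
      power.hom_ext fun k hk => by
        rw [Category.assoc, Category.id_comp, jet.truncate_π hΔ hm N hm' hk,
          power.lift_π _ (hk.trans (Nat.lt_succ_self m))]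
    have : Epi (power.lift (m + 1) (fun k => power.π N.A m k) ≫
        (jet.truncate hΔ hm N hm').f) := by rw [h]; infer_instance
    have := epi_of_epi (power.lift (m + 1) (fun k => power.π N.A m k))
      (jet.truncate hΔ hm N hm').f
    exact T.forget.epi_of_epi_map this
  refine ⟨ShortComplex.exact_of_f_is_kernel _ (KernelFork.IsLimit.ofι' _ _ fun {Z} g hg => ?_)⟩
  have H : ∃ l, l ≫ jet.top hΔ N hm' = g := by
    refine jet.exists_lift_top hΔ N hm' g fun k hk => ?_
    rw [← jet.truncate_π hΔ hm N hm' hk, ← Category.assoc]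
    exact (congrArg (fun φ : Z ⟶ jet hΔ N m hm => φ.f ≫ power.π N.A m k) hg).trans
      (by rw [zero_f, zero_comp])
  exact ⟨H.choose, H.choose_spec⟩

/-- Dévissage along the powers of `t`. -/
theorem jet.induction (P : ObjectProperty T.Algebra) (hzero : ∀ X, IsZero X → P X)
    (hext : ∀ S : ShortComplex T.Algebra, S.ShortExact → P S.X₁ → P S.X₃ → P S.X₂)
    {N : T.Algebra} (hN : P N) : ∀ (m : ℕ) (hm : m ≤ n + 1), P (jet hΔ N m hm)
  | 0, h0 => hzero _ (jet.isZero hΔ N h0)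
  | m + 1, hm' => hext _ (jet.shortExact hΔ (by omega) N hm') hN
      (jet.induction P hzero hext hN m (by omega))

variable {τ : HereditaryTorsionTheory T.Algebra} {N : T.Algebra}

theorem torsion_jet (hN : τ.torsion N) : τ.torsion (jet hΔ N m hm) :=
  jet.induction hΔ τ.torsion (fun _ => τ.torsion_of_isZero)
    (fun _ => τ.torsion_of_shortExact) hN m hm

/-- Torsion-freeness passes to jet modules, for every hereditary torsion theory: a jet module is an
iterated extension of copies of `N`. -/
theorem separated_jet (hN : τ.Separated N) : τ.Separated (jet hΔ N m hm) :=
  jet.induction hΔ τ.Separated (fun _ => τ.separated_of_isZero)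
    (fun _ => τ.separated_of_shortExact) hN m hm

theorem closed_jet (hN : τ.Closed N) : τ.Closed (jet hΔ N m hm) :=
  jet.induction hΔ τ.Closed (fun _ => τ.closed_of_isZero)
    (fun _ => τ.closed_of_shortExact) hN m hm

end Jets

/-- The two ends, distinct as `1 ≤ k`, are the terms that the recursion writes separately. -/
theorem sum_antidiagonal_eq_ends {A : Type*} [AddCommMonoid A] {k : ℕ} (hk : 1 ≤ k)
    (F : ℕ × ℕ → A) :
    ∑ p ∈ antidiagonal k, F p =
      F (k, 0) + F (0, k) + ∑ p ∈ antidiagonal k with 0 < p.1 ∧ 0 < p.2, F p := by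
  rw [← Finset.sum_filter_not_add_sum_filter (antidiagonal k) (fun p => 0 < p.1 ∧ 0 < p.2)]
  congr 1
  rw [← Finset.sum_pair (f := F) (by simp; omega)]
  refine Finset.sum_congr ?_ fun _ _ => rfl
  ext ⟨a, b⟩
  simp only [Finset.mem_filter, Finset.HasAntidiagonal.mem_antidiagonal, Finset.mem_insert,
    Finset.mem_singleton, Prod.mk.injEq]
  omega

/-! ### Morphisms from free modules -/

section Free

variable {C : Type u} [Category.{v} C] {T : Monad C}

theorem homEquiv_free {X : C} {Y : T.Algebra} (g : T.free.obj X ⟶ Y) :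
    T.adj.homEquiv X Y g = T.η.app X ≫ g.f := by
  rw [Adjunction.homEquiv_unit, Monad.adj_unit]
  rfl

theorem free_hom_ext {X : C} {Y : T.Algebra} {g g' : T.free.obj X ⟶ Y}
    (h : T.η.app X ≫ g.f = T.η.app X ≫ g'.f) : g = g' :=
  (T.adj.homEquiv X Y).injective ((homEquiv_free g).trans (h.trans (homEquiv_free g').symm))

theorem η_mapFree {X : C} {N : T.Algebra} (E : N.A ⟶ N.A) (q : T.free.obj X ⟶ N) :
    T.η.app X ≫ (mapFree E q).f = T.η.app X ≫ q.f ≫ E := by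
  have h : T.adj.homEquiv X N (mapFree E q) = T.adj.homEquiv X N q ≫ E :=
    Equiv.apply_symm_apply _ _
  rw [homEquiv_free, homEquiv_free] at h
  exact h.trans (Category.assoc _ _ _)

end Free

/-! ### Rigidity of jet families and extension of higher derivations -/

section Quotient

variable {C : Type u} [Category.{v} C] [Abelian C] {T : Monad C}
  [PreservesFiniteLimits T.toFunctor] [PreservesFiniteColimits T.toFunctor]
  {n : ℕ} {Δ : ℕ → ((T : C ⥤ C) ⟶ (T : C ⥤ C))} {τ : HereditaryTorsionTheory T.Algebra}

/-- The components are not `T`-linear one by one, but together they form a `T`-linear map to the jet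
module, which is determined on generators. -/
theorem IsJetFamily.eq_of_free (hΔ : IsHigherDerivation T n Δ) {X : C} {N : T.Algebra}
    {f f' : ℕ → ((T.free.obj X).A ⟶ N.A)} (hf : IsJetFamily Δ (n + 1) (T.free.obj X) N f)
    (hf' : IsJetFamily Δ (n + 1) (T.free.obj X) N f')
    (h : ∀ k ≤ n, T.η.app X ≫ f k = T.η.app X ≫ f' k) : ∀ k ≤ n, f k = f' k := by
  have : jet.lift hΔ le_rfl hf = jet.lift hΔ le_rfl hf' := free_hom_ext (power.hom_ext
    fun k hk => by
      have := h k (by omega)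
      erw [Category.assoc, Category.assoc, power.lift_π _ hk, power.lift_π _ hk]
      exact this)
  intro k hk
  rw [← jet.lift_π hΔ le_rfl hf (Nat.lt_succ_of_le hk), this,
    jet.lift_π hΔ le_rfl hf' (Nat.lt_succ_of_le hk)]

/-- The jet module of a separated module is separated, so the two assembled morphisms agree once
they agree on `K`. -/
theorem IsJetFamily.eq_of_torsion_cokernel (hΔ : IsHigherDerivation T n Δ) {K Y N : T.Algebra}
    {f f' : ℕ → (Y.A ⟶ N.A)} (hf : IsJetFamily Δ (n + 1) Y N f)
    (hf' : IsJetFamily Δ (n + 1) Y N f') (hN : τ.Separated N) (m : K ⟶ Y)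
    (hm : τ.torsion (cokernel m)) (h : ∀ k ≤ n, m.f ≫ f k = m.f ≫ f' k) :
    ∀ k ≤ n, f k = f' k := by
  have : jet.lift hΔ le_rfl hf = jet.lift hΔ le_rfl hf' :=
    (separated_jet hΔ le_rfl hN).hom_ext m hm (jet.hom_ext hΔ le_rfl fun k hk => by
      rw [Monad.Algebra.comp_f, Monad.Algebra.comp_f, Category.assoc, Category.assoc,
        jet.lift_π hΔ le_rfl hf hk, jet.lift_π hΔ le_rfl hf' hk, h k (by omega)])
  intro k hk
  rw [← jet.lift_π hΔ le_rfl hf (Nat.lt_succ_of_le hk), this,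
    jet.lift_π hΔ le_rfl hf' (Nat.lt_succ_of_le hk)]

/-- A higher derivation on a free module acts on a morphism `q` by the Leibniz rule. -/
theorem comp_derivation (hΔ : IsHigherDerivation T n Δ) {X : C} {N : T.Algebra}
    {E : ℕ → (N.A ⟶ N.A)} (hE : IsHigherModuleDerivation n Δ N E) (q : T.free.obj X ⟶ N) :
    ∀ k ≤ n, q.f ≫ E k =
      ∑ p ∈ antidiagonal k, (Δ p.2).app X ≫ (mapFree (E p.1) q).f := by
  -- Both sides are jet families on a free module, and on generators the right side reduces to its
  -- `k`-th map.
  refine ((isJetFamily_of_derivation hE).hom_comp q).eq_of_free hΔ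
    ((isJetFamily_free hΔ X).convolution fun k => mapFree (E k) q) fun k hk => ?_
  exact (η_mapFree _ _).symm.trans (η_convolution hΔ (fun k => (mapFree (E k) q).f) hk).symm

/-- All the `D k` extend at once, as a single morphism into the closed jet module of `Q`; its
components satisfy the Leibniz rule by construction. -/
theorem exists_derivation (hΔ : IsHigherDerivation T n Δ) {M Q : T.Algebra} (Φ : M ⟶ Q) [Mono Φ]
    (hΦ : τ.torsion (cokernel Φ)) (hs : τ.Separated Q) (hc : τ.Closed Q) {D : ℕ → (M.A ⟶ M.A)}
    (hD : IsHigherModuleDerivation n Δ M D) :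
    ∃ E : ℕ → (Q.A ⟶ Q.A), IsHigherModuleDerivation n Δ Q E ∧
      ∀ k ≤ n, Φ.f ≫ E k = D k ≫ Φ.f := by
  have hDΦ := (isJetFamily_of_derivation hD).comp_hom Φ
  obtain ⟨g, hg⟩ := closed_jet hΔ le_rfl hc Φ hΦ (jet.lift hΔ le_rfl hDΦ)
  have hE := isJetFamily_comp hΔ le_rfl g
  have hcomm : ∀ k ≤ n, Φ.f ≫ g.f ≫ power.π Q.A (n + 1) k = D k ≫ Φ.f := fun k hk => by
    rw [← Category.assoc, ← Monad.Algebra.comp_f, hg, jet.lift_π hΔ le_rfl hDΦ (by omega)]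
  refine ⟨fun k => g.f ≫ power.π Q.A (n + 1) k, ⟨?_, fun k hk => ?_⟩, hcomm⟩
  -- The constant coefficient is `T`-linear, as it involves `Δ 0` only. It is the identity on `M`,
  -- hence on `Q` by separatedness.
  · have h0 := (hE 0 (Nat.succ_pos n)).trans (Finset.sum_singleton _ (0, 0))
    rw [hΔ.zero_app] at h0
    erw [Category.id_comp] at h0
    let e : Q ⟶ Q := { f := g.f ≫ power.π Q.A (n + 1) 0, h := h0.symm }
    have : e = 𝟙 Q := hs.hom_ext Φ hΦ (Monad.Algebra.Hom.ext (by
      rw [Category.comp_id, Monad.Algebra.comp_f]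
      exact (hcomm 0 (Nat.zero_le n)).trans (by rw [hD.zero, Category.id_comp])))
    exact congrArg Monad.Algebra.Hom.f this
  · rw [hE k (by omega), Preadditive.sum_comp]
    simp only [Category.assoc]

instance mono_f {Y N : T.Algebra} (f : Y ⟶ N) [Mono f] : Mono f.f :=
  inferInstanceAs (Mono (T.forget.map f))

/-! ### The recursion and its solutions -/

variable {M : T.Algebra} {D : ℕ → (M.A ⟶ M.A)} {X : C} {I K K' : Subobject (T.free.obj X)}

theorem eq_ofLE_of_comm (hΔ : IsHigherDerivation T n Δ) (hK'K : K' ≤ K)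
    {δ : (K' : T.Algebra).A ⟶ (K : T.Algebra).A} (h : δ ≫ K.arrow.f = K'.arrow.f ≫ (Δ 0).app X) :
    δ = (Subobject.ofLE K' K hK'K).f := by
  rw [← cancel_mono K.arrow.f, h, hΔ.zero_app, ← Monad.Algebra.comp_f, Subobject.ofLE_arrow]
  exact Category.comp_id _

/-- The recursion is a convolution identity solved for its term `h k`; `h 0` accounts for the term
in `f`. -/
theorem recursion_iff (hΔ : IsHigherDerivation T n Δ) {hKI : K ≤ I} {hK'K : K' ≤ K}
    {δ : ℕ → ((K' : T.Algebra).A ⟶ (K : T.Algebra).A)} {f : (I : T.Algebra) ⟶ M}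
    {h : ℕ → ((K : T.Algebra) ⟶ M)} (hcomm : δ 0 ≫ K.arrow.f = K'.arrow.f ≫ (Δ 0).app X)
    (hzero : h 0 = Subobject.ofLE K I hKI ≫ f) {k : ℕ} (hk : 1 ≤ k) :
    ((Subobject.ofLE K' K hK'K).f ≫ (h k).f =
      (Subobject.ofLE K' I (hK'K.trans hKI)).f ≫ f.f ≫ D k -
        δ k ≫ (Subobject.ofLE K I hKI).f ≫ f.f -
        ∑ p ∈ antidiagonal k with 0 < p.1 ∧ 0 < p.2, δ p.2 ≫ (h p.1).f) ↔
    ∑ p ∈ antidiagonal k, δ p.2 ≫ (h p.1).f =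
      (Subobject.ofLE K' I (hK'K.trans hKI)).f ≫ f.f ≫ D k := by
  rw [sum_antidiagonal_eq_ends hk, eq_ofLE_of_comm hΔ hK'K hcomm, hzero, Monad.Algebra.comp_f, eq_sub_iff_add_eq,
    eq_sub_iff_add_eq]
  constructor <;> intro h <;> rw [← h] <;> abel

/-- The recursion says that `q.f ≫ E k` and the convolution of `g` with `Δ` agree on `K'`. Both are
jet families, so they agree on `TX`, and on generators the convolution is `g k`. -/
theorem mapFree_of_isLocalLift (hΔ : IsHigherDerivation T n Δ) {Q : T.Algebra} {Φ : M ⟶ Q}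
    (hs : τ.Separated Q) {E : ℕ → (Q.A ⟶ Q.A)}
    (hD : IsHigherModuleDerivation n Δ M D)
    (hE : IsHigherModuleDerivation n Δ Q E) (hDE : ∀ k ≤ n, Φ.f ≫ E k = D k ≫ Φ.f)
    {f : (I : T.Algebra) ⟶ M} {h : ℕ → ((K : T.Algebra) ⟶ M)} (hh : IsLocalLift n Δ τ D f h)
    {q : T.free.obj X ⟶ Q} (hq : I.arrow ≫ q = f ≫ Φ)
    {g : ℕ → (T.free.obj X ⟶ Q)} (hg : ∀ k, K.arrow ≫ g k = h k ≫ Φ) :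
    ∀ k ≤ n, mapFree (E k) q = g k := by
  obtain ⟨hKI, K', hK'K, δ, hK', hrec⟩ := hh
  have key : ∀ k ≤ n, q.f ≫ E k = ∑ p ∈ antidiagonal k, (Δ p.2).app X ≫ (g p.1).f := by
    refine ((isJetFamily_of_derivation hE).hom_comp q).eq_of_torsion_cokernel hΔ
      ((isJetFamily_free hΔ X).convolution g) hs K'.arrow hK' fun k hk => ?_
    have h₁ : K'.arrow.f ≫ q.f ≫ E k =
        ((Subobject.ofLE K' I (hK'K.trans hKI)).f ≫ f.f ≫ D k) ≫ Φ.f := by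
      rw [Category.assoc, Category.assoc, ← hDE k hk, ← Category.assoc f.f,
        ← Monad.Algebra.comp_f f Φ, ← hq, ← Category.assoc, ← Monad.Algebra.comp_f,
        ← Subobject.ofLE_arrow (hK'K.trans hKI)]
      simp only [Monad.Algebra.comp_f, Category.assoc]
    have h₂ : K'.arrow.f ≫ ∑ p ∈ antidiagonal k, (Δ p.2).app X ≫ (g p.1).f =
        (∑ p ∈ antidiagonal k, δ p.2 ≫ (h p.1).f) ≫ Φ.f := by
      rw [Preadditive.comp_sum, Preadditive.sum_comp]
      refine Finset.sum_congr rfl fun p hp => ?_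
      have : p.2 ≤ n := (Finset.HasAntidiagonal.antidiagonal.snd_le hp).trans hk
      rw [Category.assoc, ← Monad.Algebra.comp_f, ← hg, Monad.Algebra.comp_f, ← Category.assoc,
        hrec.comm _ this]
      exact (Category.assoc _ _ _).symm
    refine h₁.trans (Eq.trans ?_ h₂.symm)
    congr 1
    -- The recursion starts at 1; for `k = 0` the identity is `h 0 = f` on `K` together with `D 0 =
    -- 1`.
    rcases Nat.eq_zero_or_pos k with rfl | hk0
    · refine Eq.trans ?_ (Finset.sum_singleton _ (0, 0)).symm
      rw [eq_ofLE_of_comm hΔ hK'K (hrec.comm 0 hk), hrec.zero, hD.zero, Category.comp_id,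
        ← Monad.Algebra.comp_f, ← Monad.Algebra.comp_f, ← Category.assoc,
        Subobject.ofLE_comp_ofLE]
    · exact ((recursion_iff hΔ (hrec.comm 0 (Nat.zero_le n)) hrec.zero hk0).1
        (hrec.succ k hk0 hk)).symm
  intro k hk
  exact free_hom_ext ((η_mapFree _ _).trans ((congrArg (T.η.app X ≫ ·) (key k hk)).trans
    (η_convolution hΔ (fun k => (g k).f) hk)))

/-- The members of the Gabriel filter are closed under finite intersections. -/
theorem exists_le_of_mem_gabriel {Y : T.Algebra} (s : Finset ℕ) (J : ℕ → Subobject Y)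
    (hI : ∀ k ∈ s, J k ∈ τ.gabriel Y) : ∃ K ∈ τ.gabriel Y, ∀ k ∈ s, K ≤ J k := by
  classical
  obtain ⟨K, hK⟩ := (s.attach.image fun k : s =>
    (OrderDual.toDual ⟨J k, hI k k.2⟩ : τ.GabrielIndex Y)).exists_le
  exact ⟨(OrderDual.ofDual K).1, (OrderDual.ofDual K).2, fun k hk =>
    hK _ (Finset.mem_image.2 ⟨⟨k, hk⟩, Finset.mem_attach _ _, rfl⟩)⟩

/-- The elements that all `Δ k` map into a given member of the Gabriel filter form a member of the
Gabriel filter. -/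
theorem exists_mem_gabriel_comm (hΔ : IsHigherDerivation T n Δ)
    (hK : K ∈ τ.gabriel (T.free.obj X)) :
    ∃ K' ∈ τ.gabriel (T.free.obj X), K' ≤ K ∧
      ∃ δ : ℕ → ((K' : T.Algebra).A ⟶ (K : T.Algebra).A),
        ∀ j ≤ n, δ j ≫ K.arrow.f = K'.arrow.f ≫ (Δ j).app X := by
  have hφ := (isJetFamily_free hΔ X).comp_hom (cokernel.π K.arrow)
  -- An element lies in the kernel of `φ` exactly when every `Δ k` with `k ≤ n` maps it into `K`.
  -- The target is torsion, as the jet module of `TX / K`.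
  let φ := jet.lift hΔ le_rfl hφ
  have h0 : ∀ k ≤ n, (kernelSubobject φ).arrow.f ≫ (Δ k).app X ≫ (cokernel.π K.arrow).f = 0 := by
    intro k hk
    have h := congrArg (fun ψ : _ ⟶ jet hΔ (cokernel K.arrow) (n + 1) le_rfl =>
      ψ.f ≫ power.π _ (n + 1) k) (kernelSubobject_arrow_comp φ)
    simp only [Monad.Algebra.comp_f, Category.assoc, zero_f, zero_comp] at h
    rwa [jet.lift_π hΔ le_rfl hφ (Nat.lt_succ_of_le hk)] at h
  -- The `Δ j` are not `T`-linear in general, so they are lifted through `K` after forgetting to the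
  -- underlying category.
  have hex : (ShortComplex.mk K.arrow (cokernel.π K.arrow) (cokernel.condition _)).Exact :=
    ShortComplex.exact_cokernel _
  have hex' := hex.map T.forget
  have hmono : Mono ((ShortComplex.mk K.arrow (cokernel.π K.arrow)
    (cokernel.condition _)).map T.forget).f := mono_f K.arrow
  refine ⟨kernelSubobject φ, τ.kernelSubobject_mem_gabriel φ (torsion_jet hΔ le_rfl hK), ?_,
    fun j => if hj : j ≤ n then hex'.lift ((kernelSubobject φ).arrow.f ≫ (Δ j).app X)
      ((Category.assoc _ _ _).trans (h0 j hj)) else 0, fun j hj =>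
        (congrArg (· ≫ K.arrow.f) (dif_pos hj)).trans (hex'.lift_f _ _)⟩
  -- Since `Δ 0 = 1`, the constant coefficient of `φ` is the projection to `TX / K`, so the kernel
  -- lies in `K`.
  have h := h0 0 (Nat.zero_le n)
  rw [hΔ.zero_app] at h
  erw [Category.id_comp] at h
  exact Subobject.le_of_comm (Abelian.monoLift K.arrow (kernelSubobject φ).arrow
    (Monad.Algebra.Hom.ext h)) (Abelian.monoLift_comp _ _ _)

/-- The solution is read off from `Q`: `h k` is `mapFree (E k) q` restricted to where all these maps
land in `M`. That submodule is in the Gabriel filter because `Q / M` is torsion. -/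
theorem exists_isLocalLift (hΔ : IsHigherDerivation T n Δ) {Q : T.Algebra} {Φ : M ⟶ Q} [Mono Φ]
    (hΦ : τ.torsion (cokernel Φ)) {E : ℕ → (Q.A ⟶ Q.A)}
    (hE : IsHigherModuleDerivation n Δ Q E) (hDE : ∀ k ≤ n, Φ.f ≫ E k = D k ≫ Φ.f)
    (hI : I ∈ τ.gabriel (T.free.obj X)) (f : (I : T.Algebra) ⟶ M)
    {q : T.free.obj X ⟶ Q} (hq : I.arrow ≫ q = f ≫ Φ) :
    ∃ K ∈ τ.gabriel (T.free.obj X), ∃ h : ℕ → ((K : T.Algebra) ⟶ M),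
      IsLocalLift n Δ τ D f h := by
  obtain ⟨K₀, hK₀, hle₀⟩ := exists_le_of_mem_gabriel (Finset.range (n + 1))
    (fun k => kernelSubobject (mapFree (E k) q ≫ cokernel.π Φ))
    (fun k _ => τ.kernelSubobject_mem_gabriel _ hΦ)
  -- A two-element family, used to intersect `K₀` with `I`.
  obtain ⟨K, hK, hle⟩ := exists_le_of_mem_gabriel (Finset.range 2)
    (fun k => if k = 0 then I else K₀) (fun k _ => by split_ifs <;> assumption)
  have hKI : K ≤ I := hle 0 (by simp)
  have hKK₀ : K ≤ K₀ := hle 1 (by simp)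
  have hlift : ∀ k, ∃ h : (K : T.Algebra) ⟶ M, k ≤ n → h ≫ Φ = K.arrow ≫ mapFree (E k) q := by
    intro k
    by_cases hk : k ≤ n
    · have hKk := hKK₀.trans (hle₀ k (Finset.mem_range.2 (Nat.lt_succ_of_le hk)))
      have w : (K.arrow ≫ mapFree (E k) q) ≫ cokernel.π Φ = 0 := by
        rw [← Subobject.ofLE_arrow hKk, Category.assoc, Category.assoc]
        exact (_ ≫= kernelSubobject_arrow_comp _).trans comp_zero
      exact ⟨Abelian.monoLift Φ _ w, fun _ => Abelian.monoLift_comp _ _ _⟩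
    · exact ⟨0, fun h => absurd h hk⟩
  choose h hh using hlift
  obtain ⟨K', hK', hK'K, δ, hδ⟩ := exists_mem_gabriel_comm hΔ hK
  have hzero : h 0 = Subobject.ofLE K I hKI ≫ f := by
    have : mapFree (E 0) q = q := free_hom_ext ((η_mapFree _ _).trans
      (congrArg (T.η.app X ≫ ·) ((congrArg (q.f ≫ ·) hE.zero).trans (Category.comp_id _))))
    rw [← cancel_mono Φ, hh 0 (Nat.zero_le n), this, Category.assoc, ← hq, ← Category.assoc,
      Subobject.ofLE_arrow]
  refine ⟨K, hK, h, hKI, K', hK'K, δ, hK', hδ, hzero, fun k hk hkn => ?_⟩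
  -- After composition with the monomorphism `Φ` the recursion becomes `comp_derivation`, restricted
  -- to `K'`.
  refine (recursion_iff hΔ (hδ 0 (Nat.zero_le n)) hzero hk).2 ?_
  rw [← cancel_mono Φ.f, Category.assoc, Category.assoc, ← hDE k hkn, ← Category.assoc f.f,
    ← Monad.Algebra.comp_f f Φ, ← hq, Monad.Algebra.comp_f, ← Category.assoc, ← Category.assoc,
    ← Monad.Algebra.comp_f, Subobject.ofLE_arrow, Category.assoc, comp_derivation hΔ hE q k hkn,
    Preadditive.sum_comp]
  refine Eq.trans ?_ (Preadditive.comp_sum _ _ _).symm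
  refine Finset.sum_congr rfl fun p hp => ?_
  have h₁ : p.1 ≤ n := (Finset.HasAntidiagonal.antidiagonal.fst_le hp).trans hkn
  have h₂ : p.2 ≤ n := (Finset.HasAntidiagonal.antidiagonal.snd_le hp).trans hkn
  rw [Category.assoc, ← Monad.Algebra.comp_f, hh _ h₁, Monad.Algebra.comp_f, ← Category.assoc,
    hδ _ h₂]
  exact Category.assoc _ _ _

end Quotient
end

end HigherDer

/-! ### The main theorem -/

theorem mainTheorem4 {C : Type u} [Category.{v} C] [Abelian C] [IsGrothendieckAbelian.{v} C]
    {Λ : Type w} (G : Λ → C) (hsep : (ObjectProperty.ofObj G).IsSeparating)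
    (hproj : ∀ i, Projective (G i)) (hfg : ∀ i, IsFinitelyGenerated (G i))
    (T : Monad C) [PreservesFiniteLimits T.toFunctor] [PreservesColimits T.toFunctor]
    (n : ℕ) (Δ : ℕ → ((T : C ⥤ C) ⟶ (T : C ⥤ C))) (hΔ : IsHigherDerivation T n Δ)
    (τ : HereditaryTorsionTheory T.Algebra) (hτ : IsHigherDifferential n Δ τ)
    (M : T.Algebra) (hM : τ.torsionFree M)
    (D : ℕ → (M.A ⟶ M.A)) (hD : IsHigherModuleDerivation n Δ M D) :
    (∀ (i : Λ), ∀ I ∈ τ.gabriel (T.free.obj (G i)), ∀ f : (I : T.Algebra) ⟶ M,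
      ∃ K ∈ τ.gabriel (T.free.obj (G i)), ∃ h : ℕ → ((K : T.Algebra) ⟶ M),
        IsLocalLift n Δ τ D f h) ∧
    ∃ E : ℕ → ((quotientModule τ G M).obj.A ⟶ (quotientModule τ G M).obj.A),
      IsInducedFamily n Δ D (quotientModule τ G M) E ∧
      (∀ E' : ℕ → ((quotientModule τ G M).obj.A ⟶ (quotientModule τ G M).obj.A),
        IsInducedFamily n Δ D (quotientModule τ G M) E' → ∀ k ≤ n, E' k = E k) ∧
      IsHigherModuleDerivation n Δ (quotientModule τ G M).obj E ∧
      ∀ k ≤ n, (quotientModule τ G M).Φ.f ≫ E k = D k ≫ (quotientModule τ G M).Φ.f := by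
  -- As `M` is torsion-free, `M → M / M_τ` is invertible, so `Φ` is a monomorphism.
  have hπ := HereditaryTorsionTheory.isIso_π M hM
  have hmono : Mono (quotientModule τ G M).Φ :=
    inferInstanceAs (Mono (τ.π M ≫ τ.quotientMap M))
  have hΦ : τ.torsion (cokernel (quotientModule τ G M).Φ) :=
    HereditaryTorsionTheory.torsion_cokernel_comp _ _ (HereditaryTorsionTheory.torsion_cokernel_π M) (τ.torsion_cokernel_quotientMap M)
  have hs : τ.Separated (quotientModule τ G M).obj := HereditaryTorsionTheory.separated_quotientObj M
  have hc : τ.Closed (quotientModule τ G M).obj := HereditaryTorsionTheory.closed_quotientObj M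
  have hcls : ∀ {i : Λ} {I : Subobject (T.free.obj (G i))} (hI : I ∈ τ.gabriel _)
      (f : (I : T.Algebra) ⟶ M),
      I.arrow ≫ cls (quotientModule τ G M) hI f = f ≫ (quotientModule τ G M).Φ := fun hI f =>
    (τ.arrow_colimToHom_germ M _ hI (f ≫ τ.π M)).trans (Category.assoc _ _ _)
  obtain ⟨E, hE, hDE⟩ := exists_derivation hΔ _ hΦ hs hc hD
  have h1 : ∀ (i : Λ), ∀ I ∈ τ.gabriel (T.free.obj (G i)), ∀ f : (I : T.Algebra) ⟶ M,
      ∃ K ∈ τ.gabriel (T.free.obj (G i)), ∃ h : ℕ → ((K : T.Algebra) ⟶ M),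
        IsLocalLift n Δ τ D f h := fun i I hI f =>
    exists_isLocalLift hΔ hΦ hE hDE hI f (hcls hI f)
  have h2 : IsInducedFamily n Δ D (quotientModule τ G M) E := fun i I K hI hK f h hh =>
    mapFree_of_isLocalLift hΔ hs hD hE hDE hh (hcls hI f) fun k => hcls hK (h k)
  refine ⟨h1, E, h2, fun E' hE' k hk => ?_, hE, hDE⟩
  -- Each `q : T(G i) ⟶ Q` is the class of its restriction `f` to the submodule that it sends into
  -- `M`. A solution started at `f` prescribes the value at `q` of every induced family.
  refine hsep _ _ fun A hA g => ?_
  obtain ⟨i⟩ := hA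
  let q := (T.adj.homEquiv (G i) (quotientModule τ G M).obj).symm g
  let φ := q ≫ cokernel.π (quotientModule τ G M).Φ
  have hI := τ.kernelSubobject_mem_gabriel φ hΦ
  have w : ((kernelSubobject φ).arrow ≫ q) ≫ cokernel.π (quotientModule τ G M).Φ = 0 := by
    rw [Category.assoc]; exact kernelSubobject_arrow_comp φ
  let f := Abelian.monoLift (quotientModule τ G M).Φ _ w
  have hq : cls (quotientModule τ G M) hI f = q :=
    hs.hom_ext _ hI ((hcls hI f).trans (Abelian.monoLift_comp _ _ _))
  obtain ⟨K, hK, h, hh⟩ := h1 i _ hI f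
  have e := (hE' i _ K hI hK f h hh k hk).trans (h2 i _ K hI hK f h hh k hk).symm
  rw [hq] at e
  have e' := (T.adj.homEquiv (G i) (quotientModule τ G M).obj).symm.injective e
  have hg : T.adj.homEquiv (G i) (quotientModule τ G M).obj q = g := Equiv.apply_symm_apply _ _
  rwa [hg] at e'
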